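/- Let $d\in\mathbb N$ and let $P=N(\mu,\Sigma)$ and $Q=N(\nu,\Xi)$ be Gaussian distributions on $\mathbb R^d$ with $P\neq Q$, whose covariance matrices $\Sigma$ and $\Xi$ have full rank. Let $$W_2(P,Q)=\inf_{\pi}\Big(\int_{\mathbb R^d\times\mathbb R^d}\|x-y\|^2\,\pi(dx,dy)\Big)^{1/2}$$ be the 2-Wasserstein distance, where $\pi$ runs over the probability measures on $\mathbb R^d\times\mathbb R^d$ with marginals $P$ and $Q$. Let $X_1,X_2,\dots$ be independent random vectors with law $P$, let $$\hat\mu_n=\frac1n\sum_{i=1}^n X_i,\qquad \hat\Sigma_n=\frac1{n-1}\sum_{i=1}^n (X_i-\hat\mu_n)(X_i-\hat\mu_n)^t,$$ and let $\widehat{\mathcal{GW}}_n=W_2^2\big(N(\hat\mu_n,\hat\Sigma_n),Q\big)$. Let $\{(\kappa_k,r_k): k=1,\dots,d\}$ be any eigendecomposition of the symmetric matrix $\Xi^{1/2}\Sigma\,\Xi^{1/2}$ into orthonormal eigenpairs (eigenvalues $\kappa_k$, eigenvectors $r_k$), and set $$\upsilon^2=4(\nu-\mu)^t\Sigma(\nu-\mu)+2\operatorname{tr}(\Sigma^2)+2\operatorname{tr}(\Sigma\Xi)-4\sum_{k=1}^d\kappa_k^{1/2}\,r_k^t\,\Xi^{-1/2}\Sigma\,\Xi^{1/2}r_k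 .$$ Then $\upsilon^2\ge 0$ and, as $n\to\infty$, $$\sqrt n\,\big(\widehat{\mathcal{GW}}_n-W_2^2(P,Q)\big)\Rightarrow N(0,\upsilon^2),$$ where $\Rightarrow$ denotes weak convergence. -/

import Mathlib

open MeasureTheory ProbabilityTheory Filter
open scoped ENNReal Matrix MatrixOrder

noncomputable section

namespace GaussianWasserstein

/-- The set of couplings of `P` and `Q`: measures on the product space with marginals `P`, `Q`
(they are probability measures as soon as `P` is one). -/
def couplings {E : Type*} [MeasurableSpace E] (P Q : Measure E) : Set (Measure (E × E)) :=
  {π | π.map Prod.fst = P ∧ π.map Prod.snd = Q}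

/-- The `p`-Wasserstein distance, the infimum over all couplings `π` of
`(∫ ‖x - y‖ ^ p dπ(x, y)) ^ (1 / p)`, with values in `[0, ∞]`. -/
def wassersteinDist {E : Type*} [NormedAddCommGroup E] [MeasurableSpace E]
    (p : ℝ) (P Q : Measure E) : ℝ≥0∞ :=
  ⨅ π ∈ couplings P Q, (∫⁻ z, ‖z.1 - z.2‖ₑ ^ p ∂π) ^ (1 / p)

/-- The squared 2-Wasserstein distance as a real number (it is finite whenever both measures have
finite second moments, in particular for Gaussian measures). -/
def wassersteinTwoSq {E : Type*} [NormedAddCommGroup E] [MeasurableSpace E]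
    (P Q : Measure E) : ℝ :=
  (wassersteinDist 2 P Q).toReal ^ 2

variable {d : ℕ}

/-- The sample mean `n⁻¹ ∑ xᵢ` of the first `n` observations. -/
def sampleMean (x : ℕ → EuclideanSpace ℝ (Fin d)) (n : ℕ) : EuclideanSpace ℝ (Fin d) :=
  (n : ℝ)⁻¹ • ∑ i ∈ Finset.range n, x i

/-- The sample covariance matrix `(n - 1)⁻¹ ∑ (xᵢ - x̄)(xᵢ - x̄)ᵗ` of the first `n` observations
(the zero matrix if `n ≤ 1`). -/
def sampleCov (x : ℕ → EuclideanSpace ℝ (Fin d)) (n : ℕ) : Matrix (Fin d) (Fin d) ℝ :=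
  ((n : ℝ) - 1)⁻¹ • ∑ i ∈ Finset.range n,
    Matrix.vecMulVec (x i - sampleMean x n).ofLp (x i - sampleMean x n).ofLp

/-- The plug-in estimator `W₂²(N(μ̂ₙ, Σ̂ₙ), Q)` built from the first `n` observations. -/
def gaussianWassersteinEstimator (x : ℕ → EuclideanSpace ℝ (Fin d)) (n : ℕ)
    (Q : Measure (EuclideanSpace ℝ (Fin d))) : ℝ :=
  wassersteinTwoSq (multivariateGaussian (sampleMean x n) (sampleCov x n)) Q

/-- The symmetric matrix `Ξ^{1/2} Σ Ξ^{1/2}` (here `S` is `Σ`). -/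
def sandwich (S Ξ : Matrix (Fin d) (Fin d) ℝ) : Matrix (Fin d) (Fin d) ℝ :=
  CFC.sqrt Ξ * S * CFC.sqrt Ξ

/-- `(κ, r)` is an eigendecomposition of the matrix `K` into orthonormal eigenpairs. -/
def IsEigendecomposition (K : Matrix (Fin d) (Fin d) ℝ) (κ : Fin d → ℝ)
    (r : OrthonormalBasis (Fin d) ℝ (EuclideanSpace ℝ (Fin d))) : Prop :=
  ∀ k, K *ᵥ (r k).ofLp = κ k • (r k).ofLp

/-- The asymptotic variance
`4 (ν - μ)ᵗ Σ (ν - μ) + 2 tr(Σ²) + 2 tr(Σ Ξ) - 4 ∑ₖ κₖ^{1/2} rₖᵗ Ξ^{-1/2} Σ Ξ^{1/2} rₖ`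
(here `S` is `Σ`). -/
def asympVariance (μ ν : EuclideanSpace ℝ (Fin d)) (S Ξ : Matrix (Fin d) (Fin d) ℝ)
    (κ : Fin d → ℝ) (r : OrthonormalBasis (Fin d) ℝ (EuclideanSpace ℝ (Fin d))) : ℝ :=
  4 * ((ν - μ).ofLp ⬝ᵥ S *ᵥ (ν - μ).ofLp) + 2 * (S ^ 2).trace + 2 * (S * Ξ).trace
    - 4 * ∑ k, √(κ k) *
      ((r k).ofLp ⬝ᵥ ((CFC.sqrt Ξ)⁻¹ * S * CFC.sqrt Ξ) *ᵥ (r k).ofLp)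

end GaussianWasserstein

end

/-! The squared distance between Gaussians is explicit: writing `R` for `Ξ^{1/2}`, `W₂²(N(m,C),
N(ν,Ξ)) = ‖m-ν‖² + tr C + tr Ξ - 2 tr (R C R)^{1/2}`. The upper bound comes from a linear transport
map, the lower bound from quadratic Kantorovich potentials
(`wassersteinTwoSq_multivariateGaussian_eq`).

This expression is differentiable at `(μ, Σ)`. With `L² = R C R` and `L₀² = R Σ R` there is the
exact identity `2 tr L - 2 tr L₀ = tr(L₀⁻¹(L² - L₀²)) - tr(L₀⁻¹(L - L₀)²)`, and the last term is
quadratic in `C - Σ` because the square root is Lipschitz at the positive definite `L₀`. The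
derivative at `(μ, Σ)` is `(a, H) ↦ 2(μ-ν)·a + tr((1-T)H)`, where `T = R L₀⁻¹ R` is the optimal map
from `N(0,Σ)` to `N(0,Ξ)` (`exists_wassersteinTwoSq_expansion`).

At the sample moments, replacing the sample covariance by the average of `(Xᵢ-μ)(Xᵢ-μ)ᵗ` costs only
terms that vanish after multiplication by `√n`. Hence the rescaled error is, up to `o_P(1)`, the
normalized sum of the centered scalars `h(Xᵢ)`, with `h(x) = 2(μ-ν)·(x-μ) + (x-μ)ᵗ(1-T)(x-μ)`
(`exists_estimator_expansion`, `tendstoInMeasure_remainder`). The one-dimensional central limit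
theorem and Slutsky's lemma then suffice.

The limit variance is `Var h(X₁)`. Diagonalizing the quadratic form reduces it to fourth moments of
a real Gaussian (`quadratic_multivariateGaussian`), and trace algebra identifies the result with
`υ²` (`asympVariance_eq`). In particular `υ² ≥ 0`. -/

namespace GaussianWasserstein

/-! ### Square roots, traces and the Frobenius norm. -/

section MatrixLemmas

variable {ι : Type*} [Fintype ι] [DecidableEq ι]

lemma posSemidef_sqrt (A : Matrix ι ι ℝ) : (CFC.sqrt A).PosSemidef :=
  Matrix.nonneg_iff_posSemidef.1 (CFC.sqrt_nonneg A)

/-- The trace of the product of two positive semidefinite matrices is nonnegative. -/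
lemma trace_mul_nonneg {A B : Matrix ι ι ℝ} (hA : A.PosSemidef) (hB : B.PosSemidef) :
    0 ≤ (A * B).trace := by
  have hs := CFC.sqrt_mul_sqrt_self A hA.nonneg
  have hH : (CFC.sqrt A)ᴴ = CFC.sqrt A := (posSemidef_sqrt A).isHermitian
  rw [← hs, Matrix.mul_assoc, Matrix.trace_mul_comm]
  have := hB.mul_mul_conjTranspose_same (CFC.sqrt A)
  rw [hH] at this
  simpa [Matrix.mul_assoc] using this.trace_nonneg

lemma transpose_sqrt (A : Matrix ι ι ℝ) : (CFC.sqrt A)ᵀ = CFC.sqrt A := by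
  simpa using (posSemidef_sqrt A).isHermitian.eq

lemma posDef_sqrt {A : Matrix ι ι ℝ} (hA : A.PosDef) : (CFC.sqrt A).PosDef := by
  refine (posSemidef_sqrt A).posDef_iff_det_ne_zero.2 fun h ↦ ?_
  have := congrArg Matrix.det (CFC.sqrt_mul_sqrt_self A hA.posSemidef.nonneg)
  rw [Matrix.det_mul, h] at this
  exact hA.det_pos.ne' (by simpa using this.symm)

/-- The trace of a matrix computed in an orthonormal basis. -/
lemma trace_eq_sum_orthonormalBasis (N : Matrix ι ι ℝ)
    (r : OrthonormalBasis ι ℝ (EuclideanSpace ℝ ι)) :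
    N.trace = ∑ k, (r k).ofLp ⬝ᵥ N *ᵥ (r k).ofLp := by
  have h := LinearMap.trace_eq_sum_inner (Matrix.toEuclideanLin N) r
  have h2 : LinearMap.trace ℝ _ (Matrix.toEuclideanLin N) = N.trace := by
    rw [Matrix.toEuclideanLin_eq_toLin_orthonormal, Matrix.trace_toLin_eq]
  rw [← h2, h]
  refine Finset.sum_congr rfl fun k _ ↦ ?_
  simp [EuclideanSpace.inner_eq_star_dotProduct, dotProduct_comm]

/-- An eigenvector of a positive definite matrix is an eigenvector of its square root. -/
lemma sqrt_mulVec_of_eigenvector {K : Matrix ι ι ℝ} (hK : K.PosDef) {c : ℝ} {v : ι → ℝ}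
    (hv : K *ᵥ v = c • v) : CFC.sqrt K *ᵥ v = √c • v := by
  by_cases h0 : v = 0
  · simp [h0]
  have hc : 0 < c := by
    have h1 := hK.dotProduct_mulVec_pos h0
    rw [hv] at h1
    have h2 : 0 < v ⬝ᵥ v := by
      simpa using (Matrix.PosDef.one (n := ι) (R := ℝ)).dotProduct_mulVec_pos h0
    simp only [star_trivial, dotProduct_smul, smul_eq_mul] at h1
    exact pos_of_mul_pos_left h1 h2.le
  have hs := CFC.sqrt_mul_sqrt_self K hK.posSemidef.nonneg
  set L := CFC.sqrt K with hL
  -- The defect `w` satisfies `L w = -√c w`; since `L` is positive semidefinite and `√c > 0`, it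
  -- must vanish.
  set w := L *ᵥ v - √c • v with hw
  have hLw : L *ᵥ w = -(√c • w) := by
    rw [hw, Matrix.mulVec_sub, Matrix.mulVec_mulVec, hs, hv, Matrix.mulVec_smul, smul_sub,
      smul_smul, Real.mul_self_sqrt hc.le]
    abel
  have h1 := (posSemidef_sqrt K).dotProduct_mulVec_nonneg w
  rw [← hL, hLw] at h1
  simp only [star_trivial, dotProduct_neg, dotProduct_smul, smul_eq_mul] at h1
  have h2 : w = 0 := by
    by_contra h
    have h2 : 0 < w ⬝ᵥ w := by
      simpa using (Matrix.PosDef.one (n := ι) (R := ℝ)).dotProduct_mulVec_pos h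
    nlinarith [Real.sqrt_pos.2 hc]
  rwa [hw, sub_eq_zero] at h2

open scoped Matrix.Norms.Frobenius

lemma frobenius_norm_sq (A : Matrix ι ι ℝ) : ‖A‖ ^ 2 = ∑ i, ∑ j, A i j ^ 2 := by
  rw [Matrix.frobenius_norm_def, ← Real.sqrt_eq_rpow, Real.sq_sqrt (by positivity)]
  simp

lemma frobenius_norm_sq_eq_trace (A : Matrix ι ι ℝ) : ‖A‖ ^ 2 = (Aᵀ * A).trace := by
  rw [frobenius_norm_sq, Finset.sum_comm]
  simp [Matrix.trace, Matrix.mul_apply, sq]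

lemma abs_trace_mul_le (A B : Matrix ι ι ℝ) : |(A * B).trace| ≤ ‖A‖ * ‖B‖ := by
  rw [← Matrix.frobenius_norm_transpose B]
  refine abs_le_of_sq_le_sq ?_ (by positivity)
  rw [mul_pow, frobenius_norm_sq, frobenius_norm_sq]
  simp only [Matrix.trace, Matrix.diag, Matrix.mul_apply, ← Finset.sum_product']
  exact Finset.sum_mul_sq_le_sq_mul_sq Finset.univ (fun p : ι × ι ↦ A p.1 p.2)
    (fun p ↦ B p.2 p.1)

lemma frobenius_norm_vecMulVec (v : EuclideanSpace ℝ ι) :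
    ‖Matrix.vecMulVec v.ofLp v.ofLp‖ = ‖v‖ ^ 2 := by
  have : ‖Matrix.vecMulVec v.ofLp v.ofLp‖ ^ 2 = (‖v‖ ^ 2) ^ 2 := by
    rw [frobenius_norm_sq, EuclideanSpace.real_norm_sq_eq, sq (∑ i, _), Finset.sum_mul_sum]
    simp [Matrix.vecMulVec_apply, mul_pow]
  exact (pow_left_inj₀ (by positivity) (by positivity) two_ne_zero).1 this

/-- First order expansion of the trace of the square root, with an exact remainder. -/
lemma trace_sqrt_expansion {L L₀ : Matrix ι ι ℝ} (hL₀ : L₀.PosDef) :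
    2 * L.trace - 2 * L₀.trace =
      (L₀⁻¹ * (L * L - L₀ * L₀)).trace - (L₀⁻¹ * ((L - L₀) * (L - L₀))).trace := by
  have hu : IsUnit L₀.det := hL₀.det_pos.ne'.isUnit
  -- The two squares combine to `L L₀ + L₀ L - 2 L₀²`; under the trace, cyclicity cancels `L₀⁻¹`
  -- against `L₀`.
  have e : L₀⁻¹ * (L * L - L₀ * L₀) - L₀⁻¹ * ((L - L₀) * (L - L₀)) =
      L₀⁻¹ * L * L₀ + L₀⁻¹ * L₀ * L - 2 • (L₀⁻¹ * L₀ * L₀) := by noncomm_ring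
  rw [← Matrix.trace_sub, e, Matrix.trace_sub, Matrix.trace_add, Matrix.trace_mul_cycle,
    Matrix.mul_nonsing_inv _ hu, Matrix.nonsing_inv_mul _ hu, Matrix.trace_smul, one_mul, one_mul,
    nsmul_eq_mul]
  push_cast
  ring

/-- The square root is Lipschitz at a positive definite matrix, with values in the positive
semidefinite matrices. -/
lemma norm_sub_le_of_mul_self {L L₀ : Matrix ι ι ℝ} (hL : L.PosSemidef) (hL₀ : L₀.PosDef) :
    ‖L - L₀‖ ≤ ‖(CFC.sqrt L₀)⁻¹‖ ^ 2 * ‖L * L - L₀ * L₀‖ := by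
  set D := L - L₀ with hD
  set R := CFC.sqrt L₀ with hR
  have hRR : R * R = L₀ := CFC.sqrt_mul_sqrt_self L₀ hL₀.posSemidef.nonneg
  have hu : IsUnit R.det := (posDef_sqrt hL₀).det_pos.ne'.isUnit
  have hRt : Rᵀ = R := transpose_sqrt _
  have hDt : Dᵀ = D := by
    have h1 : Lᵀ = L := by simpa using hL.isHermitian.eq
    have h2 : L₀ᵀ = L₀ := by simpa using hL₀.isHermitian.eq
    rw [hD, Matrix.transpose_sub, h1, h2]
  set H := L * L - L₀ * L₀ with hH
  -- A Sylvester equation for `D`. Pairing it with `D` gives `tr(DH) = tr(DLD) + ‖RD‖²`, whose first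
  -- term is nonnegative; Cauchy–Schwarz then bounds `‖RD‖` by a multiple of `‖H‖`.
  have hHD : H = L * D + D * L₀ := by rw [hH, hD]; noncomm_ring
  set Y := R * D with hY
  have hDY : D = R⁻¹ * Y := by rw [hY, ← Matrix.mul_assoc, Matrix.nonsing_inv_mul _ hu, one_mul]
  have h1 : ‖Y‖ ^ 2 ≤ (D * H).trace := by
    have h2 : 0 ≤ (D * L * D).trace := by
      have := (hL.mul_mul_conjTranspose_same D).trace_nonneg
      simpa [hDt] using this
    have h3 : (D * (D * L₀)).trace = ‖Y‖ ^ 2 := by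
      rw [frobenius_norm_sq_eq_trace, hY, Matrix.transpose_mul, hRt, hDt, Matrix.trace_mul_comm,
        ← hRR]
      simp only [← Matrix.mul_assoc]
    rw [hHD, Matrix.mul_add, Matrix.trace_add, h3, ← Matrix.mul_assoc]
    linarith
  have h4 : ‖Y‖ ^ 2 ≤ ‖Y‖ * (‖R⁻¹‖ * ‖H‖) := by
    calc ‖Y‖ ^ 2 ≤ (D * H).trace := h1
      _ ≤ ‖D‖ * ‖H‖ := (le_abs_self _).trans (abs_trace_mul_le _ _)
      _ ≤ (‖R⁻¹‖ * ‖Y‖) * ‖H‖ := by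
        gcongr
        rw [hDY]
        exact Matrix.frobenius_norm_mul _ _
      _ = _ := by ring
  have h5 : ‖Y‖ ≤ ‖R⁻¹‖ * ‖H‖ := by
    rcases (norm_nonneg Y).eq_or_lt with h | h
    · rw [← h]; positivity
    · exact le_of_mul_le_mul_left (by rwa [← sq]) h
  calc ‖D‖ ≤ ‖R⁻¹‖ * ‖Y‖ := by
        conv_lhs => rw [hDY]
        exact Matrix.frobenius_norm_mul _ _
    _ ≤ ‖R⁻¹‖ * (‖R⁻¹‖ * ‖H‖) := by gcongr
    _ = _ := by ring

end MatrixLemmas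

/-! ### Moments and affine images of Gaussian vectors. -/

section GaussianMoments

variable {d : ℕ} {m : EuclideanSpace ℝ (Fin d)} {C : Matrix (Fin d) (Fin d) ℝ}

lemma memLp_eval_sub (i : Fin d) {p : ℝ≥0∞} (hp : p ≠ ∞) :
    MemLp (fun x ↦ (x - m).ofLp i) p (multivariateGaussian m C) := by
  have h : MemLp (fun x : EuclideanSpace ℝ (Fin d) ↦ x i) p (multivariateGaussian m C) :=
    (EuclideanSpace.proj (𝕜 := ℝ) i).comp_memLp' (IsGaussian.memLp_id _ p hp)
  exact h.sub (memLp_const _)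

lemma integral_eval_sub (i : Fin d) :
    ∫ x, (x - m).ofLp i ∂(multivariateGaussian m C) = 0 := by
  have h1 : Integrable (fun x : EuclideanSpace ℝ (Fin d) ↦ x i) (multivariateGaussian m C) :=
    (EuclideanSpace.proj (𝕜 := ℝ) i).integrable_comp IsGaussian.integrable_id
  have h2 : ∫ x : EuclideanSpace ℝ (Fin d), x i ∂(multivariateGaussian m C) = m i := by
    have := (EuclideanSpace.proj (𝕜 := ℝ) i).integral_comp_id_comm
      (μ := multivariateGaussian m C) IsGaussian.integrable_id
    simpa using this
  simp only [PiLp.sub_apply]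
  rw [integral_sub h1 (integrable_const _), h2]
  simp

lemma integral_eval_sub_mul (hC : C.PosSemidef) (i j : Fin d) :
    ∫ x, (x - m).ofLp i * (x - m).ofLp j ∂(multivariateGaussian m C) = C i j := by
  have h2 (i) : ∫ x : EuclideanSpace ℝ (Fin d), x i ∂(multivariateGaussian m C) = m i := by
    have := (EuclideanSpace.proj (𝕜 := ℝ) i).integral_comp_id_comm
      (μ := multivariateGaussian m C) IsGaussian.integrable_id
    simpa using this
  rw [← covariance_eval_multivariateGaussian (μ := m) hC i j, covariance, h2, h2]
  rfl

lemma integrable_eval_sub (i : Fin d) :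
    Integrable (fun x ↦ (x - m).ofLp i) (multivariateGaussian m C) :=
  (memLp_eval_sub (p := 1) i (by simp)).integrable le_rfl

lemma integrable_eval_sub_mul (i j : Fin d) :
    Integrable (fun x ↦ (x - m).ofLp i * (x - m).ofLp j) (multivariateGaussian m C) :=
  (memLp_eval_sub (p := 2) i (by simp)).integrable_mul (memLp_eval_sub (p := 2) j (by simp))

lemma dotProduct_mulVec_eq_sum (A : Matrix (Fin d) (Fin d) ℝ) (x : Fin d → ℝ) :
    x ⬝ᵥ A *ᵥ x = ∑ i, ∑ j, A i j * (x i * x j) := by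
  simp only [dotProduct, Matrix.mulVec, Finset.mul_sum]
  exact Finset.sum_congr rfl fun i _ ↦ Finset.sum_congr rfl fun j _ ↦ by ring

lemma integrable_quadratic (A : Matrix (Fin d) (Fin d) ℝ) :
    Integrable (fun x ↦ (x - m).ofLp ⬝ᵥ A *ᵥ (x - m).ofLp) (multivariateGaussian m C) := by
  simp only [dotProduct_mulVec_eq_sum]
  refine integrable_finsetSum _ fun i _ ↦ integrable_finsetSum _ fun j _ ↦ ?_
  exact (integrable_eval_sub_mul i j).const_mul _

lemma integral_quadratic (hC : C.PosSemidef) (A : Matrix (Fin d) (Fin d) ℝ) :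
    ∫ x, (x - m).ofLp ⬝ᵥ A *ᵥ (x - m).ofLp ∂(multivariateGaussian m C) = (A * C).trace := by
  have hi (i j) : Integrable (fun x ↦ A i j * ((x - m).ofLp i * (x - m).ofLp j))
      (multivariateGaussian m C) :=
    (integrable_eval_sub_mul i j).const_mul _
  simp only [dotProduct_mulVec_eq_sum]
  rw [integral_finsetSum _ fun i _ ↦ integrable_finsetSum _ fun j _ ↦ hi i j]
  simp only [Matrix.trace, Matrix.diag, Matrix.mul_apply]
  refine Finset.sum_congr rfl fun i _ ↦ ?_
  rw [integral_finsetSum _ fun j _ ↦ hi i j]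
  refine Finset.sum_congr rfl fun j _ ↦ ?_
  rw [integral_const_mul]
  have h1 : C j i = C i j := by simpa using hC.isHermitian.apply i j
  rw [h1, ← integral_eval_sub_mul (m := m) hC i j]

lemma integrable_linear (b : EuclideanSpace ℝ (Fin d)) :
    Integrable (fun x ↦ b.ofLp ⬝ᵥ (x - m).ofLp) (multivariateGaussian m C) := by
  simp only [dotProduct]
  exact integrable_finsetSum _ fun i _ ↦
    (integrable_eval_sub i).const_mul _

lemma integral_linear (b : EuclideanSpace ℝ (Fin d)) :
    ∫ x, b.ofLp ⬝ᵥ (x - m).ofLp ∂(multivariateGaussian m C) = 0 := by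
  simp only [dotProduct]
  rw [integral_finsetSum _ fun i _ ↦
    (integrable_eval_sub i).const_mul _]
  refine Finset.sum_eq_zero fun i _ ↦ ?_
  rw [integral_const_mul]
  rw [integral_eval_sub, mul_zero]

lemma integrable_linear_add_quadratic (b : EuclideanSpace ℝ (Fin d))
    (A : Matrix (Fin d) (Fin d) ℝ) :
    Integrable (fun x ↦ b.ofLp ⬝ᵥ (x - m).ofLp + (x - m).ofLp ⬝ᵥ A *ᵥ (x - m).ofLp)
      (multivariateGaussian m C) :=
  (integrable_linear b).add (integrable_quadratic A)

lemma integral_linear_add_quadratic (hC : C.PosSemidef) (b : EuclideanSpace ℝ (Fin d))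
    (A : Matrix (Fin d) (Fin d) ℝ) :
    ∫ x, (b.ofLp ⬝ᵥ (x - m).ofLp + (x - m).ofLp ⬝ᵥ A *ᵥ (x - m).ofLp)
      ∂(multivariateGaussian m C) = (A * C).trace := by
  rw [integral_add (integrable_linear _) (integrable_quadratic _), integral_linear,
    integral_quadratic hC, zero_add]

/-- The affine image of a Gaussian distribution. -/
lemma map_affine_multivariateGaussian (hC : C.PosSemidef) (n : EuclideanSpace ℝ (Fin d))
    (A : Matrix (Fin d) (Fin d) ℝ) :
    (multivariateGaussian m C).map (fun x ↦ n + Matrix.toEuclideanCLM (𝕜 := ℝ) A (x - m)) =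
      multivariateGaussian n (A * C * Aᵀ) := by
  have hACA : (A * C * Aᵀ).PosSemidef := by simpa using hC.mul_mul_conjTranspose_same A
  apply Measure.ext_of_charFun
  ext t
  rw [charFun_multivariateGaussian hACA, charFun_apply, integral_map (by fun_prop) (by fun_prop)]
  have h1 (x : EuclideanSpace ℝ (Fin d)) :
      Complex.exp (inner ℝ (n + Matrix.toEuclideanCLM (𝕜 := ℝ) A (x - m)) t * Complex.I) =
      Complex.exp ((inner ℝ n t - inner ℝ m (Matrix.toEuclideanCLM (𝕜 := ℝ) Aᵀ t)) * Complex.I) *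
        Complex.exp (inner ℝ x (Matrix.toEuclideanCLM (𝕜 := ℝ) Aᵀ t) * Complex.I) := by
    have h2 : inner ℝ (Matrix.toEuclideanCLM (𝕜 := ℝ) A (x - m)) t =
        inner ℝ (x - m) (Matrix.toEuclideanCLM (𝕜 := ℝ) Aᵀ t) := by
      simp only [EuclideanSpace.inner_eq_star_dotProduct, Matrix.ofLp_toEuclideanCLM, star_trivial]
      rw [Matrix.dotProduct_mulVec, Matrix.mulVec_transpose]
    rw [← Complex.exp_add, inner_add_left, h2, inner_sub_left]
    push_cast
    ring_nf
  simp only [h1]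
  rw [integral_const_mul, ← charFun_apply, charFun_multivariateGaussian hC, ← Complex.exp_add]
  have h3 : (Matrix.toEuclideanCLM (𝕜 := ℝ) Aᵀ t).ofLp ⬝ᵥ
      C *ᵥ (Matrix.toEuclideanCLM (𝕜 := ℝ) Aᵀ t).ofLp = t.ofLp ⬝ᵥ (A * C * Aᵀ) *ᵥ t.ofLp := by
    rw [Matrix.ofLp_toEuclideanCLM, ← Matrix.mulVec_mulVec, ← Matrix.mulVec_mulVec,
      Matrix.dotProduct_mulVec t.ofLp, Matrix.mulVec_transpose]
  rw [h3, real_inner_comm n t, real_inner_comm m (Matrix.toEuclideanCLM (𝕜 := ℝ) Aᵀ t)]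
  ring_nf

end GaussianMoments

/-! ### The closed formula for the distance between Gaussians. -/

section WassersteinFormula

variable {d : ℕ} {m ν : EuclideanSpace ℝ (Fin d)} {C Ξ A : Matrix (Fin d) (Fin d) ℝ}

/-- Only an inequality, because the negative part of `g` is discarded on the right; this suffices
for duality, where the sum of potentials may change sign. -/
lemma ofReal_integral_le_lintegral_ofReal {α : Type*} [MeasurableSpace α] {ρ : Measure α}
    {g : α → ℝ} (hg : Integrable g ρ) :
    ENNReal.ofReal (∫ z, g z ∂ρ) ≤ ∫⁻ z, ENNReal.ofReal (g z) ∂ρ := by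
  rw [integral_eq_lintegral_pos_part_sub_lintegral_neg_part hg]
  refine (ENNReal.ofReal_le_ofReal (sub_le_self _ ENNReal.toReal_nonneg)).trans ?_
  exact ENNReal.ofReal_toReal_le

lemma ofReal_norm_sq {E : Type*} [SeminormedAddCommGroup E] (x : E) :
    ENNReal.ofReal (‖x‖ ^ 2) = ‖x‖ₑ ^ (2 : ℝ) := by
  rw [ENNReal.ofReal_pow (norm_nonneg _), ofReal_norm, ENNReal.rpow_two]

lemma norm_sq_eq_dotProduct (x : EuclideanSpace ℝ (Fin d)) : ‖x‖ ^ 2 = x.ofLp ⬝ᵥ x.ofLp := by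
  rw [EuclideanSpace.real_norm_sq_eq, dotProduct]
  exact Finset.sum_congr rfl fun i _ ↦ sq _

/-- Young's inequality for the quadratic form of a positive definite matrix. -/
lemma two_mul_dotProduct_le (hA : A.PosDef) (x y : Fin d → ℝ) :
    2 * (x ⬝ᵥ y) ≤ x ⬝ᵥ A⁻¹ *ᵥ x + y ⬝ᵥ A *ᵥ y := by
  have hu : IsUnit A.det := hA.det_pos.ne'.isUnit
  -- Young's inequality is the nonnegativity of the form of `A⁻¹` at `x - A y`.
  have h := hA.inv.posSemidef.dotProduct_mulVec_nonneg (x - A *ᵥ y)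
  have hAt : Aᵀ = A := by simpa using hA.isHermitian.eq
  have h1 : A⁻¹ *ᵥ (x - A *ᵥ y) = A⁻¹ *ᵥ x - y := by
    rw [Matrix.mulVec_sub, Matrix.mulVec_mulVec, Matrix.nonsing_inv_mul _ hu, Matrix.one_mulVec]
  have h2 (w : Fin d → ℝ) : (A *ᵥ y) ⬝ᵥ w = y ⬝ᵥ A *ᵥ w := by
    rw [Matrix.dotProduct_mulVec, ← Matrix.mulVec_transpose, hAt]
  rw [star_trivial, h1, sub_dotProduct, h2, Matrix.mulVec_sub, Matrix.mulVec_mulVec,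
    Matrix.mul_nonsing_inv _ hu, Matrix.one_mulVec, dotProduct_sub, dotProduct_sub,
    dotProduct_comm y x] at h
  linarith

/-- Kantorovich duality (the easy half) with quadratic potentials. -/
lemma ofReal_le_lintegral_of_mem_couplings (hC : C.PosSemidef) (hΞ : Ξ.PosSemidef) (hA : A.PosDef)
    {π : Measure (EuclideanSpace ℝ (Fin d) × EuclideanSpace ℝ (Fin d))}
    (hπ : π ∈ couplings (multivariateGaussian m C) (multivariateGaussian ν Ξ)) :
    ENNReal.ofReal (‖m - ν‖ ^ 2 + C.trace + Ξ.trace - (A⁻¹ * C).trace - (A * Ξ).trace) ≤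
      ∫⁻ z, ‖z.1 - z.2‖ₑ ^ (2 : ℝ) ∂π := by
  obtain ⟨h1, h2⟩ := hπ
  have : IsProbabilityMeasure π := by
    constructor
    have := congrArg (fun ρ ↦ ρ Set.univ) h1
    simpa [Measure.map_apply measurable_fst MeasurableSet.univ] using this
  -- The potentials are centered at the two means, so their linear parts integrate to zero. That
  -- `‖m-ν‖² + f x + g y` lies below `‖x-y‖²` is Young's inequality for `A`.
  let f : EuclideanSpace ℝ (Fin d) → ℝ := fun x ↦
    ((2 : ℝ) • (m - ν)).ofLp ⬝ᵥ (x - m).ofLp + (x - m).ofLp ⬝ᵥ (1 - A⁻¹) *ᵥ (x - m).ofLp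
  let g : EuclideanSpace ℝ (Fin d) → ℝ := fun y ↦
    ((-2 : ℝ) • (m - ν)).ofLp ⬝ᵥ (y - ν).ofLp + (y - ν).ofLp ⬝ᵥ (1 - A) *ᵥ (y - ν).ofLp
  have hf : Integrable f (π.map Prod.fst) :=
    h1 ▸ integrable_linear_add_quadratic _ _
  have hg : Integrable g (π.map Prod.snd) :=
    h2 ▸ integrable_linear_add_quadratic _ _
  have hf' : Integrable (fun z ↦ f z.1) π := hf.comp_measurable measurable_fst
  have hg' : Integrable (fun z ↦ g z.2) π := hg.comp_measurable measurable_snd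
  have hfi : ∫ z, f z.1 ∂π = C.trace - (A⁻¹ * C).trace := by
    rw [← integral_map (f := f) measurable_fst.aemeasurable hf.aestronglyMeasurable, h1]
    simp only [f]
    rw [integral_linear_add_quadratic hC, sub_mul, Matrix.trace_sub, one_mul]
  have hgi : ∫ z, g z.2 ∂π = Ξ.trace - (A * Ξ).trace := by
    rw [← integral_map (f := g) measurable_snd.aemeasurable hg.aestronglyMeasurable, h2]
    simp only [g]
    rw [integral_linear_add_quadratic hΞ, sub_mul, Matrix.trace_sub, one_mul]
  have hfg : Integrable (fun z ↦ f z.1 + g z.2) π := hf'.add hg'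
  have htot : ∫ z, (‖m - ν‖ ^ 2 + (f z.1 + g z.2)) ∂π =
      ‖m - ν‖ ^ 2 + C.trace + Ξ.trace - (A⁻¹ * C).trace - (A * Ξ).trace := by
    rw [integral_add (integrable_const _) hfg, integral_add hf' hg', hfi, hgi]
    simp
    ring
  rw [← htot]
  refine (ofReal_integral_le_lintegral_ofReal ((integrable_const _).add hfg)).trans
    (lintegral_mono fun z ↦ ?_)
  rw [← ofReal_norm_sq]
  change ENNReal.ofReal (‖m - ν‖ ^ 2 + (f z.1 + g z.2)) ≤ _
  refine ENNReal.ofReal_le_ofReal ?_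
  have e : z.1 - z.2 = (m - ν) + ((z.1 - m) - (z.2 - ν)) := by abel
  rw [e, norm_sq_eq_dotProduct, norm_sq_eq_dotProduct]
  simp only [f, g]
  have h := two_mul_dotProduct_le hA (z.1 - m).ofLp (z.2 - ν).ofLp
  simp only [WithLp.ofLp_add, WithLp.ofLp_sub (x := z.1 - m), WithLp.ofLp_smul]
  generalize (z.1 - m).ofLp = x at *
  generalize (z.2 - ν).ofLp = y at *
  generalize (m - ν).ofLp = w at *
  simp only [Matrix.sub_mulVec, Matrix.one_mulVec, dotProduct_sub, sub_dotProduct, dotProduct_add,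
    add_dotProduct, smul_dotProduct, smul_eq_mul, dotProduct_comm x w, dotProduct_comm y w,
    dotProduct_comm y x]
  linarith

/-- The trace bound behind the regularization `A + ε` of a singular optimal map `A`. -/
lemma trace_inv_mul_le (hΞ : Ξ.PosSemidef) (hA : A.PosSemidef) {ε : ℝ} (hε : 0 < ε) :
    ((A + ε • 1)⁻¹ * (A * Ξ * A)).trace ≤ (A * Ξ).trace := by
  have hB : (A + ε • 1).PosDef := Matrix.PosDef.posSemidef_add hA (Matrix.PosDef.one.smul hε)
  set B := A + ε • 1 with hBdef
  have hu : IsUnit B.det := hB.det_pos.ne'.isUnit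
  have hBt : (B⁻¹)ᵀ = B⁻¹ := by simpa using hB.inv.isHermitian.eq
  have hAt : Aᵀ = A := by simpa using hA.isHermitian.eq
  -- Hence the left trace is `tr(AΞ) - ε tr(A B⁻¹ Ξ)`, and the correction has a sign once `A B⁻¹` is
  -- known to be positive semidefinite.
  have h1 : B⁻¹ * A = 1 - ε • B⁻¹ := by
    have : A = B - ε • 1 := by rw [hBdef]; abel
    conv_lhs => rw [this]
    rw [mul_sub, Matrix.nonsing_inv_mul _ hu]
    simp
  have hpsd : (A * B⁻¹).PosSemidef := by
    have h2 : A * B⁻¹ = B⁻¹ * (A * A + ε • A) * B⁻¹ := by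
      have : A * A + ε • A = B * A := by rw [hBdef, add_mul]; simp
      rw [this, ← mul_assoc, Matrix.nonsing_inv_mul _ hu, one_mul]
    rw [h2]
    have h3 : (A * A + ε • A).PosSemidef := by
      refine Matrix.PosSemidef.add ?_ (hA.smul hε.le)
      have := Matrix.posSemidef_self_mul_conjTranspose A
      rwa [Matrix.conjTranspose_eq_transpose_of_trivial, hAt] at this
    have := h3.mul_mul_conjTranspose_same B⁻¹
    rwa [Matrix.conjTranspose_eq_transpose_of_trivial, hBt] at this
  have h4 : (B⁻¹ * (A * Ξ * A)).trace = (A * Ξ).trace - ε * ((A * B⁻¹) * Ξ).trace := by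
    rw [← mul_assoc, ← mul_assoc, h1, sub_mul, sub_mul, one_mul, Matrix.trace_sub,
      Matrix.smul_mul, Matrix.smul_mul, Matrix.trace_smul, Matrix.trace_mul_comm Ξ A,
      Matrix.trace_mul_cycle, smul_eq_mul]
  rw [h4]
  have := trace_mul_nonneg hpsd hΞ
  nlinarith

/-- The coupling given by the linear optimal map. -/
lemma exists_coupling (hΞ : Ξ.PosSemidef) (hA : A.PosSemidef) :
    ∃ π ∈ couplings (multivariateGaussian m (A * Ξ * A)) (multivariateGaussian ν Ξ),
      ∃ w, ∫⁻ z, ‖z.1 - z.2‖ₑ ^ (2 : ℝ) ∂π = ENNReal.ofReal w ∧ 0 ≤ w ∧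
        w = ‖m - ν‖ ^ 2 + (A * Ξ * A).trace + Ξ.trace - 2 * (A * Ξ).trace := by
  have hAt : Aᵀ = A := by simpa using hA.isHermitian.eq
  let T : EuclideanSpace ℝ (Fin d) → EuclideanSpace ℝ (Fin d) × EuclideanSpace ℝ (Fin d) :=
    fun y ↦ (m + Matrix.toEuclideanCLM (𝕜 := ℝ) A (y - ν), y)
  have hT : Measurable T := by fun_prop
  have hTn (y) : ‖(T y).1 - (T y).2‖ ^ 2 = ‖m - ν‖ ^ 2 +
      ((((2 : ℝ) • Matrix.toEuclideanCLM (𝕜 := ℝ) (A - 1) (m - ν)).ofLp ⬝ᵥ (y - ν).ofLp) +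
        (y - ν).ofLp ⬝ᵥ ((A - 1) * (A - 1)) *ᵥ (y - ν).ofLp) := by
    have e : (T y).1 - (T y).2 = (m - ν) + Matrix.toEuclideanCLM (𝕜 := ℝ) (A - 1) (y - ν) := by
      simp only [T, map_sub, map_one, sub_apply, one_apply_eq_self]
      abel
    have hS : (A - 1)ᵀ = A - 1 := by rw [Matrix.transpose_sub, hAt, Matrix.transpose_one]
    have h2 (u w : Fin d → ℝ) : ((A - 1) *ᵥ u) ⬝ᵥ w = u ⬝ᵥ (A - 1) *ᵥ w := by
      rw [Matrix.dotProduct_mulVec, ← Matrix.mulVec_transpose, hS]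
    rw [e, norm_sq_eq_dotProduct, norm_sq_eq_dotProduct]
    simp only [WithLp.ofLp_add, WithLp.ofLp_smul, Matrix.ofLp_toEuclideanCLM, add_dotProduct,
      dotProduct_add, smul_dotProduct, smul_eq_mul, ← Matrix.mulVec_mulVec, h2]
    have h3 : (y - ν).ofLp ⬝ᵥ (A - 1) *ᵥ (m - ν).ofLp =
        (m - ν).ofLp ⬝ᵥ (A - 1) *ᵥ (y - ν).ofLp := by rw [dotProduct_comm, h2]
    linear_combination h3
  have hint : Integrable (fun y ↦ ‖(T y).1 - (T y).2‖ ^ 2) (multivariateGaussian ν Ξ) := by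
    simp only [hTn]
    exact (integrable_const _).add (integrable_linear_add_quadratic _ _)
  refine ⟨(multivariateGaussian ν Ξ).map T, ⟨?_, ?_⟩,
    ∫ y, ‖(T y).1 - (T y).2‖ ^ 2 ∂(multivariateGaussian ν Ξ), ?_,
    integral_nonneg fun y ↦ by positivity, ?_⟩
  · rw [Measure.map_map measurable_fst hT]
    have := map_affine_multivariateGaussian (m := ν) hΞ m A
    rwa [hAt] at this
  · rw [Measure.map_map measurable_snd hT]
    exact Measure.map_id
  · rw [lintegral_map (by fun_prop) hT,
      ofReal_integral_eq_lintegral_ofReal hint (ae_of_all _ fun y ↦ by positivity)]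
    simp only [ofReal_norm_sq]
  · simp only [hTn]
    rw [integral_add (integrable_const _) (integrable_linear_add_quadratic _ _),
      integral_linear_add_quadratic hΞ]
    have e : (A - 1) * (A - 1) * Ξ = A * A * Ξ - A * Ξ - A * Ξ + Ξ := by noncomm_ring
    rw [e, Matrix.trace_add, Matrix.trace_sub, Matrix.trace_sub, Matrix.trace_mul_cycle A Ξ A]
    simp
    ring

/-- The squared 2-Wasserstein distance between two Gaussian distributions whose covariance matrices
are linked by a positive semidefinite matrix `A`. -/
theorem wassersteinTwoSq_multivariateGaussian (hΞ : Ξ.PosSemidef) (hA : A.PosSemidef) :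
    wassersteinTwoSq (multivariateGaussian m (A * Ξ * A)) (multivariateGaussian ν Ξ) =
      ‖m - ν‖ ^ 2 + (A * Ξ * A).trace + Ξ.trace - 2 * (A * Ξ).trace := by
  obtain ⟨π₀, hπ₀, w, hw, hw0, hweq⟩ := exists_coupling (m := m) (ν := ν) hΞ hA
  have hAt : Aᵀ = A := by simpa using hA.isHermitian.eq
  have hC : (A * Ξ * A).PosSemidef := by
    have := hΞ.mul_mul_conjTranspose_same A
    rwa [Matrix.conjTranspose_eq_transpose_of_trivial, hAt] at this
  have hlow {π} (hπ : π ∈ couplings (multivariateGaussian m (A * Ξ * A))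
      (multivariateGaussian ν Ξ)) :
      ENNReal.ofReal w ≤ ∫⁻ z, ‖z.1 - z.2‖ₑ ^ (2 : ℝ) ∂π := by
    -- Duality needs an invertible matrix while `A` may be singular: it is applied to `A + ε`, at a
    -- cost of at most `ε tr Ξ`, which disappears as `ε → 0`.
    have h1 (ε : ℝ) (hε : 0 < ε) :
        ENNReal.ofReal (w - ε * Ξ.trace) ≤ ∫⁻ z, ‖z.1 - z.2‖ₑ ^ (2 : ℝ) ∂π := by
      refine le_trans (ENNReal.ofReal_le_ofReal ?_) (ofReal_le_lintegral_of_mem_couplings hC hΞ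
        (Matrix.PosDef.posSemidef_add hA (Matrix.PosDef.one.smul hε)) hπ)
      have := trace_inv_mul_le hΞ hA hε
      rw [add_mul, Matrix.trace_add, Matrix.smul_mul, Matrix.trace_smul, one_mul, smul_eq_mul]
      linarith
    have h2 : Tendsto (fun ε : ℝ ↦ ENNReal.ofReal (w - ε * Ξ.trace)) (nhdsWithin 0 (Set.Ioi 0))
        (nhds (ENNReal.ofReal w)) := by
      have : Continuous fun ε : ℝ ↦ ENNReal.ofReal (w - ε * Ξ.trace) :=
        ENNReal.continuous_ofReal.comp (by fun_prop)
      have h3 := this.tendsto 0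
      simp only [zero_mul, sub_zero] at h3
      exact h3.mono_left nhdsWithin_le_nhds
    exact le_of_tendsto h2 (eventually_nhdsWithin_of_forall fun ε hε ↦ h1 ε hε)
  have hdist : wassersteinDist 2 (multivariateGaussian m (A * Ξ * A)) (multivariateGaussian ν Ξ) =
      ENNReal.ofReal w ^ (1 / (2 : ℝ)) := by
    refine le_antisymm ?_ ?_
    · rw [← hw]
      exact iInf₂_le π₀ hπ₀
    · exact le_iInf₂ fun π hπ ↦ ENNReal.rpow_le_rpow (hlow hπ) (by norm_num)
  rw [wassersteinTwoSq, hdist, ← ENNReal.toReal_rpow, ENNReal.toReal_ofReal hw0,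
    ← Real.sqrt_eq_rpow, Real.sq_sqrt hw0, hweq]

/-- The squared 2-Wasserstein distance between Gaussian distributions. -/
theorem wassersteinTwoSq_multivariateGaussian_eq (hC : C.PosSemidef) (hΞ : Ξ.PosDef) :
    wassersteinTwoSq (multivariateGaussian m C) (multivariateGaussian ν Ξ) =
      ‖m - ν‖ ^ 2 + C.trace + Ξ.trace - 2 * (CFC.sqrt (sandwich C Ξ)).trace := by
  set R := CFC.sqrt Ξ with hR
  have hRR : R * R = Ξ := CFC.sqrt_mul_sqrt_self Ξ hΞ.posSemidef.nonneg
  have hu : IsUnit R.det := (posDef_sqrt hΞ).det_pos.ne'.isUnit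
  have hRi : (R⁻¹)ᵀ = R⁻¹ := by simpa using (posDef_sqrt hΞ).inv.isHermitian.eq
  have hK : (sandwich C Ξ).PosSemidef := by
    have := hC.mul_mul_conjTranspose_same R
    rwa [Matrix.conjTranspose_eq_transpose_of_trivial, transpose_sqrt] at this
  set L := CFC.sqrt (sandwich C Ξ) with hL
  have hLL : L * L = R * C * R := CFC.sqrt_mul_sqrt_self _ hK.nonneg
  -- This is the linear map transporting `N(0,Ξ)` to `N(0,C)`; it exists for singular `C`, since
  -- only `Ξ` is inverted.
  have hA : (R⁻¹ * L * R⁻¹).PosSemidef := by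
    have := (posSemidef_sqrt (sandwich C Ξ)).mul_mul_conjTranspose_same R⁻¹
    rwa [Matrix.conjTranspose_eq_transpose_of_trivial, hRi] at this
  have h1 : R⁻¹ * L * R⁻¹ * Ξ = R⁻¹ * L * R := by
    rw [← hRR, ← mul_assoc, mul_assoc _ R⁻¹ R, Matrix.nonsing_inv_mul _ hu, mul_one]
  have h2 : R⁻¹ * L * R⁻¹ * Ξ * (R⁻¹ * L * R⁻¹) = C := by
    calc R⁻¹ * L * R⁻¹ * Ξ * (R⁻¹ * L * R⁻¹) = R⁻¹ * L * (R * R⁻¹) * L * R⁻¹ := by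
          rw [h1]; noncomm_ring
      _ = R⁻¹ * (L * L) * R⁻¹ := by rw [Matrix.mul_nonsing_inv _ hu]; noncomm_ring
      _ = (R⁻¹ * R) * C * (R * R⁻¹) := by rw [hLL]; noncomm_ring
      _ = C := by rw [Matrix.mul_nonsing_inv _ hu, Matrix.nonsing_inv_mul _ hu, one_mul, mul_one]
  have h3 : (R⁻¹ * L * R⁻¹ * Ξ).trace = L.trace := by
    rw [h1, Matrix.trace_mul_cycle, Matrix.mul_nonsing_inv _ hu, one_mul]
  have := wassersteinTwoSq_multivariateGaussian (m := m) (ν := ν) hΞ.posSemidef hA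
  rwa [h2, h3] at this

end WassersteinFormula

/-! ### Variance of a linear plus quadratic form of a Gaussian vector. -/

section Variance

open Real in
-- Differentiating the Gaussian moment generating function keeps the form polynomial times
-- `exp(t²/2)`, with `p ↦ p' + t p`; four steps starting from `p = 1` give the fourth moment.
lemma hasDerivAt_mul_exp_sq {p : ℝ → ℝ} {p' t : ℝ} (hp : HasDerivAt p p' t) :
    HasDerivAt (fun t ↦ p t * rexp (t ^ 2 / 2)) ((p' + t * p t) * rexp (t ^ 2 / 2)) t := by
  have h : HasDerivAt (fun t : ℝ ↦ rexp (t ^ 2 / 2)) (rexp (t ^ 2 / 2) * t) t := by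
    convert (((hasDerivAt_id' t).fun_pow 2).div_const 2).exp using 1
    simp
  exact (hp.fun_mul h).congr_deriv (by ring)

lemma integral_pow_four_gaussianReal : ∫ x, x ^ 4 ∂(gaussianReal 0 1) = 3 := by
  have h : ∫ x, x ^ 4 ∂(gaussianReal 0 1) =
      iteratedDeriv 4 (mgf (fun x ↦ x) (gaussianReal 0 1)) 0 := by
    rw [iteratedDeriv_mgf_zero] <;> simp
  have e0 : mgf (fun x ↦ x) (gaussianReal 0 1) = fun t ↦ 1 * Real.exp (t ^ 2 / 2) := by
    rw [mgf_fun_id_gaussianReal]; simp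
  have e1 : deriv (fun t : ℝ ↦ 1 * Real.exp (t ^ 2 / 2)) = fun t ↦ t * Real.exp (t ^ 2 / 2) := by
    ext t
    rw [(hasDerivAt_mul_exp_sq (hasDerivAt_const t (1 : ℝ))).deriv]; ring
  have e2 : deriv (fun t : ℝ ↦ t * Real.exp (t ^ 2 / 2)) =
      fun t ↦ (1 + t ^ 2) * Real.exp (t ^ 2 / 2) := by
    ext t
    rw [(hasDerivAt_mul_exp_sq (hasDerivAt_id' t)).deriv]; ring
  have e3 : deriv (fun t : ℝ ↦ (1 + t ^ 2) * Real.exp (t ^ 2 / 2)) =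
      fun t ↦ (3 * t + t ^ 3) * Real.exp (t ^ 2 / 2) := by
    ext t
    rw [(hasDerivAt_mul_exp_sq (((hasDerivAt_id' t).fun_pow 2).const_add 1)).deriv]; simp; ring
  have e4 : deriv (fun t : ℝ ↦ (3 * t + t ^ 3) * Real.exp (t ^ 2 / 2)) =
      fun t ↦ (3 + 6 * t ^ 2 + t ^ 4) * Real.exp (t ^ 2 / 2) := by
    ext t
    rw [(hasDerivAt_mul_exp_sq (((hasDerivAt_id' t).const_mul 3).fun_add
      ((hasDerivAt_id' t).fun_pow 3))).deriv]; simp; ring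
  rw [h, iteratedDeriv_succ, iteratedDeriv_succ, iteratedDeriv_succ, iteratedDeriv_one, e0, e1, e2,
    e3, e4]
  simp

lemma integral_pow_three_gaussianReal : ∫ x, x ^ 3 ∂(gaussianReal 0 1) = 0 := by
  have h : ∫ x, x ^ 3 ∂((gaussianReal 0 1).map (fun x ↦ -x)) = ∫ x, (-x) ^ 3 ∂(gaussianReal 0 1) :=
    integral_map (by fun_prop) (by fun_prop)
  rw [gaussianReal_map_neg, neg_zero] at h
  simp only [Odd.neg_pow (by decide : Odd 3), integral_neg] at h
  linarith

lemma integral_sq_gaussianReal : ∫ x, x ^ 2 ∂(gaussianReal 0 1) = 1 := by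
  have h := variance_of_integral_eq_zero (μ := gaussianReal 0 1) (X := fun x ↦ x) (by fun_prop)
    (by simp)
  rw [variance_fun_id_gaussianReal] at h
  simpa using h.symm

lemma integrable_pow_gaussianReal (k : ℕ) : Integrable (fun x ↦ x ^ k) (gaussianReal 0 1) := by
  rcases Nat.eq_zero_or_pos k with rfl | hk
  · simp
  · have := (memLp_id_gaussianReal' (μ := 0) (v := 1) (k : ℝ≥0∞)
      (by simp)).integrable_norm_pow hk.ne'
    refine (integrable_norm_iff (by fun_prop)).1 ?_
    simpa [norm_pow] using this

lemma memLp_quadratic_gaussianReal (b c : ℝ) :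
    MemLp (fun x ↦ b * x + c * x ^ 2) 2 (gaussianReal 0 1) := by
  rw [memLp_two_iff_integrable_sq (by fun_prop)]
  have h (x : ℝ) : (b * x + c * x ^ 2) ^ 2 =
      b ^ 2 * x ^ 2 + (2 * b * c * x ^ 3 + c ^ 2 * x ^ 4) := by
    ring
  simp only [h]
  have := integrable_pow_gaussianReal
  exact ((this 2).const_mul _).add (((this 3).const_mul _).add ((this 4).const_mul _))

lemma variance_quadratic_gaussianReal (b c : ℝ) :
    Var[fun x ↦ b * x + c * x ^ 2; gaussianReal 0 1] = b ^ 2 + 2 * c ^ 2 := by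
  have hi := integrable_pow_gaussianReal
  have h (x : ℝ) : (b * x + c * x ^ 2) ^ 2 =
      b ^ 2 * x ^ 2 + (2 * b * c * x ^ 3 + c ^ 2 * x ^ 4) := by
    ring
  have hi1 : Integrable (fun x : ℝ ↦ b * x) (gaussianReal 0 1) := by simpa using (hi 1).const_mul b
  rw [variance_eq_sub (memLp_quadratic_gaussianReal b c)]
  simp only [Pi.pow_apply, h]
  have hb : ∫ x, b * x ∂(gaussianReal 0 1) = 0 := by
    rw [integral_const_mul, integral_id_gaussianReal, mul_zero]
  have h34 : Integrable (fun x : ℝ ↦ 2 * b * c * x ^ 3 + c ^ 2 * x ^ 4) (gaussianReal 0 1) :=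
    ((hi 3).const_mul _).add ((hi 4).const_mul _)
  rw [integral_add ((hi 2).const_mul _) h34,
    integral_add ((hi 3).const_mul _) ((hi 4).const_mul _), integral_add hi1 ((hi 2).const_mul _)]
  simp only [hb, integral_const_mul, integral_pow_four_gaussianReal,
    integral_pow_three_gaussianReal, integral_sq_gaussianReal]
  ring

variable {d : ℕ}

lemma quadratic_sum_eigenvectorBasis {M : Matrix (Fin d) (Fin d) ℝ} (hM : M.IsHermitian)
    (b : EuclideanSpace ℝ (Fin d)) (g : Fin d → ℝ) :
    b.ofLp ⬝ᵥ (∑ i, g i • hM.eigenvectorBasis i).ofLp +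
      (∑ i, g i • hM.eigenvectorBasis i).ofLp ⬝ᵥ M *ᵥ (∑ i, g i • hM.eigenvectorBasis i).ofLp =
    ∑ i, (inner ℝ b (hM.eigenvectorBasis i) * g i + hM.eigenvalues i * g i ^ 2) := by
  have h1 (x y : EuclideanSpace ℝ (Fin d)) : x.ofLp ⬝ᵥ y.ofLp = inner ℝ x y := by
    simp [EuclideanSpace.inner_eq_star_dotProduct, dotProduct_comm]
  have h2 : M *ᵥ (∑ i, g i • hM.eigenvectorBasis i).ofLp =
      (∑ i, (g i * hM.eigenvalues i) • hM.eigenvectorBasis i).ofLp := by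
    simp only [WithLp.ofLp_sum, WithLp.ofLp_smul, Matrix.mulVec_sum, Matrix.mulVec_smul,
      hM.mulVec_eigenvectorBasis, smul_smul]
  rw [h2, h1, h1, inner_sum, hM.eigenvectorBasis.orthonormal.inner_sum, ← Finset.sum_add_distrib]
  refine Finset.sum_congr rfl fun i _ ↦ ?_
  rw [inner_smul_right]
  simp
  ring

/-- A linear plus quadratic form of a standard Gaussian vector. -/
lemma quadratic_stdGaussian {M : Matrix (Fin d) (Fin d) ℝ} (hM : M.IsHermitian)
    (b : EuclideanSpace ℝ (Fin d)) :
    MemLp (fun x ↦ b.ofLp ⬝ᵥ x.ofLp + x.ofLp ⬝ᵥ M *ᵥ x.ofLp) 2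
        (stdGaussian (EuclideanSpace ℝ (Fin d))) ∧
      Var[fun x ↦ b.ofLp ⬝ᵥ x.ofLp + x.ofLp ⬝ᵥ M *ᵥ x.ofLp;
        stdGaussian (EuclideanSpace ℝ (Fin d))] = ‖b‖ ^ 2 + 2 * (M * M).trace := by
  have hq : Continuous fun x : EuclideanSpace ℝ (Fin d) ↦
      b.ofLp ⬝ᵥ x.ofLp + x.ofLp ⬝ᵥ M *ᵥ x.ofLp := by
    simp only [dotProduct]
    fun_prop
  have hmem (i : Fin d) := memLp_quadratic_gaussianReal (inner ℝ b (hM.eigenvectorBasis i))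
    (hM.eigenvalues i)
  have hcomp : (fun x : EuclideanSpace ℝ (Fin d) ↦ b.ofLp ⬝ᵥ x.ofLp + x.ofLp ⬝ᵥ M *ᵥ x.ofLp) ∘
      (fun g : Fin d → ℝ ↦ ∑ i, g i • hM.eigenvectorBasis i) =
      ∑ i, fun g ↦ inner ℝ b (hM.eigenvectorBasis i) * g i + hM.eigenvalues i * g i ^ 2 := by
    ext g
    rw [Function.comp_apply, quadratic_sum_eigenvectorBasis hM b g, Finset.sum_apply]
  have hmap : Measurable (fun g : Fin d → ℝ ↦ ∑ i, g i • hM.eigenvectorBasis i) := by fun_prop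
  -- The standard Gaussian has independent standard coordinates in the eigenbasis of `M` too, and
  -- there the form is a sum of one-variable quadratics.
  rw [stdGaussian_eq_map_pi_orthonormalBasis hM.eigenvectorBasis,
    memLp_map_measure_iff hq.aestronglyMeasurable hmap.aemeasurable,
    variance_map hq.aemeasurable hmap.aemeasurable, hcomp]
  constructor
  · refine memLp_finsetSum' _ fun i _ ↦ ?_
    exact (hmem i).comp_measurePreserving (measurePreserving_eval _ i)
  · rw [variance_sum_pi hmem]
    simp only [variance_quadratic_gaussianReal, Finset.sum_add_distrib]
    rw [hM.eigenvectorBasis.sum_sq_inner_left, ← Finset.mul_sum,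
      trace_eq_sum_orthonormalBasis _ hM.eigenvectorBasis]
    congr 2
    refine Finset.sum_congr rfl fun i _ ↦ ?_
    rw [← Matrix.mulVec_mulVec, hM.mulVec_eigenvectorBasis, Matrix.mulVec_smul,
      hM.mulVec_eigenvectorBasis, dotProduct_smul, dotProduct_smul, ← norm_sq_eq_dotProduct]
    simp [sq]

/-- A linear plus quadratic form of a Gaussian vector. -/
lemma quadratic_multivariateGaussian {m : EuclideanSpace ℝ (Fin d)} {C : Matrix (Fin d) (Fin d) ℝ}
    (hC : C.PosSemidef) {B : Matrix (Fin d) (Fin d) ℝ} (hB : Bᵀ = B)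
    (b : EuclideanSpace ℝ (Fin d)) :
    MemLp (fun x ↦ b.ofLp ⬝ᵥ (x - m).ofLp + (x - m).ofLp ⬝ᵥ B *ᵥ (x - m).ofLp) 2
        (multivariateGaussian m C) ∧
      Var[fun x ↦ b.ofLp ⬝ᵥ (x - m).ofLp + (x - m).ofLp ⬝ᵥ B *ᵥ (x - m).ofLp;
        multivariateGaussian m C] = b.ofLp ⬝ᵥ C *ᵥ b.ofLp + 2 * (B * C * (B * C)).trace := by
  set R := CFC.sqrt C with hR
  have hRR : R * R = C := CFC.sqrt_mul_sqrt_self C hC.nonneg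
  have hRt : Rᵀ = R := transpose_sqrt _
  have hM : (R * B * R).IsHermitian := by
    rw [Matrix.IsHermitian, Matrix.conjTranspose_eq_transpose_of_trivial, Matrix.transpose_mul,
      Matrix.transpose_mul, hRt, hB, mul_assoc]
  have hsym (u w : Fin d → ℝ) : (R *ᵥ u) ⬝ᵥ w = u ⬝ᵥ R *ᵥ w := by
    rw [Matrix.dotProduct_mulVec, ← Matrix.mulVec_transpose, hRt]
  have hq : Continuous fun x : EuclideanSpace ℝ (Fin d) ↦
      b.ofLp ⬝ᵥ (x - m).ofLp + (x - m).ofLp ⬝ᵥ B *ᵥ (x - m).ofLp := by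
    simp only [dotProduct]
    fun_prop
  have hmap : Measurable fun x : EuclideanSpace ℝ (Fin d) ↦
      m + Matrix.toEuclideanCLM (𝕜 := ℝ) R x := by fun_prop
  have hcomp : (fun x : EuclideanSpace ℝ (Fin d) ↦
      b.ofLp ⬝ᵥ (x - m).ofLp + (x - m).ofLp ⬝ᵥ B *ᵥ (x - m).ofLp) ∘
      (fun x ↦ m + Matrix.toEuclideanCLM (𝕜 := ℝ) R x) =
      fun x ↦ (Matrix.toEuclideanCLM (𝕜 := ℝ) R b).ofLp ⬝ᵥ x.ofLp +
        x.ofLp ⬝ᵥ (R * B * R) *ᵥ x.ofLp := by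
    ext x
    simp only [Function.comp_apply, add_sub_cancel_left, Matrix.ofLp_toEuclideanCLM, hsym,
      Matrix.mulVec_mulVec, mul_assoc]
  have h := quadratic_stdGaussian hM (Matrix.toEuclideanCLM (𝕜 := ℝ) R b)
  rw [multivariateGaussian, memLp_map_measure_iff hq.aestronglyMeasurable hmap.aemeasurable,
    variance_map hq.aemeasurable hmap.aemeasurable, hcomp]
  refine ⟨h.1, h.2.trans ?_⟩
  rw [norm_sq_eq_dotProduct, Matrix.ofLp_toEuclideanCLM, hsym, Matrix.mulVec_mulVec, hRR]
  have e : (R * B * R * (R * B * R)).trace = (B * C * (B * C)).trace := by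
    calc (R * B * R * (R * B * R)).trace = (R * (B * (R * R) * B * R)).trace := by
          congr 1; noncomm_ring
      _ = (B * (R * R) * (B * (R * R))).trace := by
          rw [Matrix.trace_mul_comm]; congr 1; noncomm_ring
      _ = _ := by rw [hRR]
  rw [e]

end Variance

/-! ### First-order expansion of the distance and of the estimator. -/

section Expansion

variable {d : ℕ}

lemma posDef_sandwich {S Ξ : Matrix (Fin d) (Fin d) ℝ} (hS : S.PosDef) (hΞ : Ξ.PosDef) :
    (sandwich S Ξ).PosDef := by
  have hu : IsUnit (CFC.sqrt Ξ).det := (posDef_sqrt hΞ).det_pos.ne'.isUnit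
  have h := hS.posSemidef.mul_mul_conjTranspose_same (CFC.sqrt Ξ)
  rw [Matrix.conjTranspose_eq_transpose_of_trivial, transpose_sqrt] at h
  refine h.posDef_iff_det_ne_zero.2 ?_
  rw [Matrix.det_mul, Matrix.det_mul]
  exact mul_ne_zero (mul_ne_zero hu.ne_zero hS.det_pos.ne') hu.ne_zero

lemma posSemidef_sandwich {C : Matrix (Fin d) (Fin d) ℝ} (hC : C.PosSemidef)
    (Ξ : Matrix (Fin d) (Fin d) ℝ) : (sandwich C Ξ).PosSemidef := by
  have h := hC.mul_mul_conjTranspose_same (CFC.sqrt Ξ)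
  rwa [Matrix.conjTranspose_eq_transpose_of_trivial, transpose_sqrt] at h

/-- The matrix of the optimal transport map from `N(0, S)` to `N(0, Ξ)`. -/
noncomputable def optimalMap (S Ξ : Matrix (Fin d) (Fin d) ℝ) : Matrix (Fin d) (Fin d) ℝ :=
  CFC.sqrt Ξ * (CFC.sqrt (sandwich S Ξ))⁻¹ * CFC.sqrt Ξ

lemma transpose_one_sub_optimalMap (S Ξ : Matrix (Fin d) (Fin d) ℝ) :
    (1 - optimalMap S Ξ)ᵀ = 1 - optimalMap S Ξ := by
  rw [optimalMap, Matrix.transpose_sub, Matrix.transpose_one, Matrix.transpose_mul,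
    Matrix.transpose_mul, Matrix.transpose_nonsing_inv, transpose_sqrt, transpose_sqrt, mul_assoc]

/-- The right side is the variance of the influence function `h`. With `T` the optimal map, `L² = R
S R` gives `T S = R L R⁻¹` and `T S T = Ξ`, so expanding `tr(((1-T)S)²)` yields the stated traces.
-/
lemma asympVariance_eq {μ ν : EuclideanSpace ℝ (Fin d)} {S Ξ : Matrix (Fin d) (Fin d) ℝ}
    (hS : S.PosDef) (hΞ : Ξ.PosDef) {κ : Fin d → ℝ}
    {r : OrthonormalBasis (Fin d) ℝ (EuclideanSpace ℝ (Fin d))}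
    (heig : IsEigendecomposition (sandwich S Ξ) κ r) :
    asympVariance μ ν S Ξ κ r =
      ((2 : ℝ) • (μ - ν)).ofLp ⬝ᵥ S *ᵥ ((2 : ℝ) • (μ - ν)).ofLp +
        2 * ((1 - optimalMap S Ξ) * S * ((1 - optimalMap S Ξ) * S)).trace := by
  have hK := posDef_sandwich hS hΞ
  have hRu : IsUnit (CFC.sqrt Ξ).det := (posDef_sqrt hΞ).det_pos.ne'.isUnit
  have hLu : IsUnit (CFC.sqrt (sandwich S Ξ)).det := (posDef_sqrt hK).det_pos.ne'.isUnit
  have hRR : CFC.sqrt Ξ * CFC.sqrt Ξ = Ξ := CFC.sqrt_mul_sqrt_self Ξ hΞ.posSemidef.nonneg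
  have hLL : CFC.sqrt (sandwich S Ξ) * CFC.sqrt (sandwich S Ξ) = CFC.sqrt Ξ * S * CFC.sqrt Ξ :=
    CFC.sqrt_mul_sqrt_self _ hK.posSemidef.nonneg
  -- Each `r k` is an eigenvector of `L` with eigenvalue `√(κ k)`, so the spectral sum is a trace
  -- computed in the basis `r`, whatever eigendecomposition was chosen.
  have hsum : ∑ k, √(κ k) * ((r k).ofLp ⬝ᵥ ((CFC.sqrt Ξ)⁻¹ * S * CFC.sqrt Ξ) *ᵥ (r k).ofLp) =
      ((CFC.sqrt Ξ)⁻¹ * S * CFC.sqrt Ξ * CFC.sqrt (sandwich S Ξ)).trace := by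
    rw [trace_eq_sum_orthonormalBasis _ r]
    refine Finset.sum_congr rfl fun k _ ↦ ?_
    rw [← Matrix.mulVec_mulVec _ _ (CFC.sqrt (sandwich S Ξ)),
      sqrt_mulVec_of_eigenvector hK (heig k), Matrix.mulVec_smul, dotProduct_smul, smul_eq_mul]
  rw [asympVariance, hsum, optimalMap]
  generalize CFC.sqrt (sandwich S Ξ) = L at *
  generalize CFC.sqrt Ξ = R at *
  have hLi : L⁻¹ * L = 1 := Matrix.nonsing_inv_mul _ hLu
  have hLi' : L * L⁻¹ = 1 := Matrix.mul_nonsing_inv _ hLu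
  have hRi' : R * R⁻¹ = 1 := Matrix.mul_nonsing_inv _ hRu
  have h2 : R * L⁻¹ * R * S = R * L * R⁻¹ := by
    calc R * L⁻¹ * R * S = R * L⁻¹ * (R * S * (R * R⁻¹)) := by rw [hRi']; noncomm_ring
      _ = R * L⁻¹ * ((R * S * R) * R⁻¹) := by noncomm_ring
      _ = R * (L⁻¹ * L) * L * R⁻¹ := by rw [← hLL]; noncomm_ring
      _ = R * L * R⁻¹ := by rw [hLi, mul_one]
  have h3 : (R * L⁻¹ * R * S * S).trace = (R⁻¹ * S * R * L).trace := by
    rw [h2, mul_assoc, Matrix.trace_mul_comm, ← mul_assoc]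
  have h4 : (R * L⁻¹ * R * S * (R * L⁻¹ * R * S)).trace = (S * Ξ).trace := by
    have : R * L⁻¹ * R * S * (R * L⁻¹ * R * S) = Ξ * S := by
      calc R * L⁻¹ * R * S * (R * L⁻¹ * R * S) = R * L⁻¹ * (R * S * R) * L⁻¹ * R * S := by
            noncomm_ring
        _ = R * (L⁻¹ * L) * (L * L⁻¹) * R * S := by rw [← hLL]; noncomm_ring
        _ = Ξ * S := by rw [hLi, hLi', mul_one, mul_one, hRR]
    rw [this, Matrix.trace_mul_comm]
  have h5 : (S * (R * L⁻¹ * R * S)).trace = (R⁻¹ * S * R * L).trace := by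
    rw [Matrix.trace_mul_comm, h3]
  have e : (1 - R * L⁻¹ * R) * S * ((1 - R * L⁻¹ * R) * S) =
      S ^ 2 - S * (R * L⁻¹ * R * S) - R * L⁻¹ * R * S * S +
        R * L⁻¹ * R * S * (R * L⁻¹ * R * S) := by noncomm_ring
  rw [e, Matrix.trace_add, Matrix.trace_sub, Matrix.trace_sub, h3, h4, h5]
  have h6 : ((2 : ℝ) • (μ - ν)).ofLp ⬝ᵥ S *ᵥ ((2 : ℝ) • (μ - ν)).ofLp =
      4 * ((ν - μ).ofLp ⬝ᵥ S *ᵥ (ν - μ).ofLp) := by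
    have : μ - ν = -(ν - μ) := by abel
    rw [this]
    simp only [WithLp.ofLp_smul, WithLp.ofLp_neg, Matrix.mulVec_smul, Matrix.mulVec_neg,
      dotProduct_smul, smul_dotProduct, neg_dotProduct, dotProduct_neg, smul_eq_mul]
    ring
  rw [h6]
  ring

open scoped Matrix.Norms.Frobenius

/-- Quadratic bound for the linearization of the squared Wasserstein distance. -/
lemma exists_wassersteinTwoSq_expansion (μ ν : EuclideanSpace ℝ (Fin d))
    {S Ξ : Matrix (Fin d) (Fin d) ℝ} (hS : S.PosDef) (hΞ : Ξ.PosDef) :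
    ∃ c, 0 ≤ c ∧ ∀ (m : EuclideanSpace ℝ (Fin d)) (C : Matrix (Fin d) (Fin d) ℝ), C.PosSemidef →
      |wassersteinTwoSq (multivariateGaussian m C) (multivariateGaussian ν Ξ) -
        wassersteinTwoSq (multivariateGaussian μ S) (multivariateGaussian ν Ξ) -
        (((2 : ℝ) • (μ - ν)).ofLp ⬝ᵥ (m - μ).ofLp +
          ((1 - optimalMap S Ξ) * (C - S)).trace)| ≤ ‖m - μ‖ ^ 2 + c * ‖C - S‖ ^ 2 := by
  set R := CFC.sqrt Ξ with hR
  set L₀ := CFC.sqrt (sandwich S Ξ) with hL₀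
  have hK := posDef_sandwich hS hΞ
  have hL₀p : L₀.PosDef := posDef_sqrt hK
  -- The inner factor is the Lipschitz constant of the square root at `L₀` times `‖R‖²` from the
  -- sandwich; it is squared because the remainder is quadratic in `L - L₀`.
  refine ⟨‖L₀⁻¹‖ * (‖(CFC.sqrt L₀)⁻¹‖ ^ 2 * (‖R‖ * ‖R‖)) ^ 2, by positivity, fun m C hC ↦ ?_⟩
  rw [wassersteinTwoSq_multivariateGaussian_eq hC hΞ,
    wassersteinTwoSq_multivariateGaussian_eq hS.posSemidef hΞ, ← hL₀]
  set L := CFC.sqrt (sandwich C Ξ) with hL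
  have hLL : L * L = R * C * R :=
    CFC.sqrt_mul_sqrt_self _ (posSemidef_sandwich hC Ξ).nonneg
  have hLL₀ : L₀ * L₀ = R * S * R := CFC.sqrt_mul_sqrt_self _ hK.posSemidef.nonneg
  have hH : L * L - L₀ * L₀ = R * (C - S) * R := by rw [hLL, hLL₀]; noncomm_ring
  have hexp := trace_sqrt_expansion (L := L) hL₀p
  have hlip := norm_sub_le_of_mul_self (posSemidef_sqrt (sandwich C Ξ)) hL₀p
  rw [← hL, hH] at hlip
  rw [hH] at hexp
  have hHn : ‖R * (C - S) * R‖ ≤ ‖R‖ * ‖R‖ * ‖C - S‖ := by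
    calc ‖R * (C - S) * R‖ ≤ ‖R‖ * ‖C - S‖ * ‖R‖ := (Matrix.frobenius_norm_mul _ _).trans
          (by gcongr; exact Matrix.frobenius_norm_mul _ _)
      _ = _ := by ring
  have hρ : |(L₀⁻¹ * ((L - L₀) * (L - L₀))).trace| ≤
      ‖L₀⁻¹‖ * (‖(CFC.sqrt L₀)⁻¹‖ ^ 2 * (‖R‖ * ‖R‖)) ^ 2 * ‖C - S‖ ^ 2 := by
    calc |(L₀⁻¹ * ((L - L₀) * (L - L₀))).trace| ≤ ‖L₀⁻¹‖ * ‖(L - L₀) * (L - L₀)‖ :=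
          abs_trace_mul_le _ _
      _ ≤ ‖L₀⁻¹‖ * (‖L - L₀‖ * ‖L - L₀‖) := by gcongr; exact Matrix.frobenius_norm_mul _ _
      _ = ‖L₀⁻¹‖ * ‖L - L₀‖ ^ 2 := by ring
      _ ≤ ‖L₀⁻¹‖ * (‖(CFC.sqrt L₀)⁻¹‖ ^ 2 * (‖R‖ * ‖R‖ * ‖C - S‖)) ^ 2 := by
          gcongr
          exact hlip.trans (by gcongr)
      _ = _ := by ring
  have htr : (optimalMap S Ξ * (C - S)).trace = (L₀⁻¹ * (R * (C - S) * R)).trace := by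
    rw [optimalMap, ← hR, ← hL₀, mul_assoc, mul_assoc, Matrix.trace_mul_comm]
    congr 1
    noncomm_ring
  have hn : ‖m - ν‖ ^ 2 = ‖m - μ‖ ^ 2 + ((2 : ℝ) • (μ - ν)).ofLp ⬝ᵥ (m - μ).ofLp +
      ‖μ - ν‖ ^ 2 := by
    have : m - ν = (m - μ) + (μ - ν) := by abel
    rw [this, norm_sq_eq_dotProduct, norm_sq_eq_dotProduct, norm_sq_eq_dotProduct,
      WithLp.ofLp_add, WithLp.ofLp_smul]
    simp only [add_dotProduct, dotProduct_add, smul_dotProduct, smul_eq_mul,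
      dotProduct_comm (m - μ).ofLp (μ - ν).ofLp]
    ring
  rw [sub_mul, Matrix.trace_sub, one_mul, Matrix.trace_sub, htr, hn]
  calc _ = |‖m - μ‖ ^ 2 + (L₀⁻¹ * ((L - L₀) * (L - L₀))).trace| := by
        congr 1; linarith
    _ ≤ |‖m - μ‖ ^ 2| + |(L₀⁻¹ * ((L - L₀) * (L - L₀))).trace| := abs_add_le _ _
    _ ≤ _ := by rw [abs_of_nonneg (by positivity)]; gcongr

/-- The centered empirical second moment matrix. -/
noncomputable def secondMomentDev (μ : EuclideanSpace ℝ (Fin d)) (S : Matrix (Fin d) (Fin d) ℝ)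
    (x : ℕ → EuclideanSpace ℝ (Fin d)) (n : ℕ) : Matrix (Fin d) (Fin d) ℝ :=
  (n : ℝ)⁻¹ • ∑ i ∈ Finset.range n, (Matrix.vecMulVec (x i - μ).ofLp (x i - μ).ofLp - S)

lemma posSemidef_sampleCov (x : ℕ → EuclideanSpace ℝ (Fin d)) (n : ℕ) :
    (sampleCov x n).PosSemidef := by
  -- For `n = 0` the factor `(n-1)⁻¹` is negative, but the sum is empty; for `n = 1` it is `0⁻¹ =
  -- 0`.
  rcases Nat.eq_zero_or_pos n with rfl | hn
  · simpa [sampleCov] using Matrix.PosSemidef.zero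
  · refine Matrix.PosSemidef.smul (Matrix.posSemidef_sum _ fun i _ ↦ ?_) ?_
    · simpa using Matrix.posSemidef_vecMulVec_self_star (x i - sampleMean x n).ofLp
    · have : (1 : ℝ) ≤ n := by exact_mod_cast hn
      exact inv_nonneg.2 (by linarith)

lemma sampleMean_sub (μ : EuclideanSpace ℝ (Fin d)) (x : ℕ → EuclideanSpace ℝ (Fin d)) {n : ℕ}
    (hn : n ≠ 0) : sampleMean x n - μ = (n : ℝ)⁻¹ • ∑ i ∈ Finset.range n, (x i - μ) := by
  have : (n : ℝ) ≠ 0 := by exact_mod_cast hn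
  rw [Finset.sum_sub_distrib, smul_sub, sampleMean, Finset.sum_const, Finset.card_range,
    ← Nat.cast_smul_eq_nsmul ℝ, smul_smul, inv_mul_cancel₀ this, one_smul]

/-- Recentering at `μ` costs `n` times the square of the mean error, and `n/(n-1) = 1 + 1/(n-1)`.
This isolates the average of i.i.d. terms from corrections of lower order. -/
lemma sampleCov_sub (μ : EuclideanSpace ℝ (Fin d)) (S : Matrix (Fin d) (Fin d) ℝ)
    (x : ℕ → EuclideanSpace ℝ (Fin d)) {n : ℕ} (hn : 2 ≤ n) :
    sampleCov x n - S = ((n : ℝ) - 1)⁻¹ • S + (1 + ((n : ℝ) - 1)⁻¹) • (secondMomentDev μ S x n -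
      Matrix.vecMulVec (sampleMean x n - μ).ofLp (sampleMean x n - μ).ofLp) := by
  have h2 : (2 : ℝ) ≤ n := by exact_mod_cast hn
  have h0 : (n : ℝ) ≠ 0 := by linarith
  have h1 : (n : ℝ) - 1 ≠ 0 := by linarith
  have hm (k : Fin d) : ∑ i ∈ Finset.range n, (x i - μ).ofLp k =
      n * (sampleMean x n - μ).ofLp k := by
    rw [sampleMean_sub μ x (by omega)]
    simp [h0]
  ext j k
  have hs : ∑ i ∈ Finset.range n, (x i - sampleMean x n).ofLp j * (x i - sampleMean x n).ofLp k =
      ∑ i ∈ Finset.range n, (x i - μ).ofLp j * (x i - μ).ofLp k -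
        n * ((sampleMean x n - μ).ofLp j * (sampleMean x n - μ).ofLp k) := by
    have e (i) : (x i - sampleMean x n).ofLp j * (x i - sampleMean x n).ofLp k =
        (x i - μ).ofLp j * (x i - μ).ofLp k - (x i - μ).ofLp j * (sampleMean x n - μ).ofLp k -
        (x i - μ).ofLp k * (sampleMean x n - μ).ofLp j +
        (sampleMean x n - μ).ofLp j * (sampleMean x n - μ).ofLp k := by
      simp only [PiLp.sub_apply]; ring
    simp only [e, Finset.sum_add_distrib, Finset.sum_sub_distrib, ← Finset.sum_mul, hm]
    simp
    ring
  have hT : secondMomentDev μ S x n j k =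
      (n : ℝ)⁻¹ * ∑ i ∈ Finset.range n, (x i - μ).ofLp j * (x i - μ).ofLp k - S j k := by
    simp only [secondMomentDev, Matrix.smul_apply, Matrix.sum_apply, Matrix.sub_apply,
      Matrix.vecMulVec_apply, Finset.sum_sub_distrib, smul_eq_mul, mul_sub]
    simp [h0]
  have hc : sampleCov x n j k = ((n : ℝ) - 1)⁻¹ *
      ∑ i ∈ Finset.range n, (x i - sampleMean x n).ofLp j * (x i - sampleMean x n).ofLp k := by
    simp only [sampleCov, Matrix.smul_apply, Matrix.sum_apply, Matrix.vecMulVec_apply, smul_eq_mul]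
  rw [Matrix.sub_apply, hc, hs, Matrix.add_apply, Matrix.smul_apply, Matrix.smul_apply,
    Matrix.sub_apply, hT, Matrix.vecMulVec_apply]
  simp only [smul_eq_mul]
  generalize ∑ i ∈ Finset.range n, (x i - μ).ofLp j * (x i - μ).ofLp k = σ
  field_simp
  ring

/-- Used with `s = √n`, `t = n^{-1/2}` and `q` the squared fluctuations. After multiplication by
`s`, all terms are controlled through `s t² = t`, `s t⁴ ≤ t` and `s q² ≤ (s q)² = U²`. -/
lemma remainder_bound {s t q b σ c U : ℝ} (hs : 1 ≤ s) (hst : s * t = 1) (hq : 0 ≤ q)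
    (hb : 0 ≤ b) (hσ : 0 ≤ σ) (hc : 0 ≤ c) (hU : U = s * q) :
    s * (b * (2 * (σ + 1) * t ^ 2 + 4 * q) + (q + c * (12 * (σ ^ 2 * t ^ 4 + q + q ^ 2)))) ≤
      (1 + 4 * b + 2 * b * (σ + 1) + 12 * c * (1 + σ ^ 2)) * (U + U ^ 2 + t) := by
  have ht : 0 ≤ t := (pos_of_mul_pos_right (hst ▸ one_pos) (by linarith)).le
  have ht1 : t ≤ 1 := by nlinarith
  have hU0 : 0 ≤ U := by rw [hU]; positivity
  have h2 : s * t ^ 2 = t := by rw [sq, ← mul_assoc, hst, one_mul]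
  have h4 : s * t ^ 4 ≤ t := by
    have : s * t ^ 4 = (s * t ^ 2) * t ^ 2 := by ring
    rw [this, h2]
    exact mul_le_of_le_one_right ht (pow_le_one₀ ht ht1)
  have hq2 : s * q ^ 2 ≤ U ^ 2 := by
    rw [hU, mul_pow]
    gcongr
    nlinarith
  calc _ = b * (2 * (σ + 1) * (s * t ^ 2) + 4 * (s * q)) + (s * q +
      c * (12 * (σ ^ 2 * (s * t ^ 4) + s * q + s * q ^ 2))) := by ring
    _ ≤ b * (2 * (σ + 1) * t + 4 * U) + (U + c * (12 * (σ ^ 2 * t + U + U ^ 2))) := by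
        rw [h2, ← hU]; gcongr
    _ ≤ _ := by
        have i1 : U ≤ U + U ^ 2 + t := by nlinarith
        have i2 : t ≤ U + U ^ 2 + t := by nlinarith
        have i3 : U + U ^ 2 ≤ U + U ^ 2 + t := by linarith
        generalize hZ : U + U ^ 2 + t = Z at *
        calc _ = 2 * b * (σ + 1) * t + 4 * b * U + U + 12 * c * σ ^ 2 * t +
              12 * c * (U + U ^ 2) := by ring
          _ ≤ 2 * b * (σ + 1) * Z + 4 * b * Z + Z + 12 * c * σ ^ 2 * Z + 12 * c * Z := by gcongr
          _ = _ := by ring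

/-- Deterministic bound for the remainder of the linearized estimator. -/
lemma exists_estimator_expansion (μ ν : EuclideanSpace ℝ (Fin d))
    {S Ξ : Matrix (Fin d) (Fin d) ℝ} (hS : S.PosDef) (hΞ : Ξ.PosDef) :
    ∃ c, 0 ≤ c ∧ ∀ (x : ℕ → EuclideanSpace ℝ (Fin d)) (n : ℕ), 2 ≤ n →
      ∀ U, U = √n * (‖sampleMean x n - μ‖ ^ 2 + ‖secondMomentDev μ S x n‖ ^ 2) →
      |√n * (gaussianWassersteinEstimator x n (multivariateGaussian ν Ξ) -
        wassersteinTwoSq (multivariateGaussian μ S) (multivariateGaussian ν Ξ)) -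
        √n * (((2 : ℝ) • (μ - ν)).ofLp ⬝ᵥ (sampleMean x n - μ).ofLp +
          ((1 - optimalMap S Ξ) * secondMomentDev μ S x n).trace)| ≤ c * (U + U ^ 2 + (√n)⁻¹) := by
  obtain ⟨c, hc, hexp⟩ := exists_wassersteinTwoSq_expansion μ ν hS hΞ
  set B := 1 - optimalMap S Ξ with hB
  refine ⟨1 + 4 * ‖B‖ + 2 * ‖B‖ * (‖S‖ + 1) + 12 * c * (1 + ‖S‖ ^ 2), by positivity,
    fun x n hn U hU ↦ ?_⟩
  have h := hexp (sampleMean x n) (sampleCov x n) (posSemidef_sampleCov x n)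
  have hcov := sampleCov_sub μ S x hn
  rw [gaussianWassersteinEstimator]
  set a := sampleMean x n - μ with ha
  set T := secondMomentDev μ S x n with hT
  set H := sampleCov x n - S with hH
  set V := Matrix.vecMulVec a.ofLp a.ofLp with hV
  have hVn : ‖V‖ = ‖a‖ ^ 2 := frobenius_norm_vecMulVec a
  have hn2 : (2 : ℝ) ≤ n := by exact_mod_cast hn
  set s := √(n : ℝ) with hs
  have hs1 : 1 ≤ s := Real.one_le_sqrt.2 (by linarith)
  have hss : s ^ 2 = n := Real.sq_sqrt (by linarith)
  set α := ((n : ℝ) - 1)⁻¹ with hα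
  have hα0 : 0 ≤ α := inv_nonneg.2 (by linarith)
  have hα1 : α ≤ 1 := inv_le_one_of_one_le₀ (by linarith)
  have hα2 : α ≤ 2 * (s⁻¹) ^ 2 := by
    rw [inv_pow, hss, hα, ← div_eq_mul_inv, inv_eq_one_div, div_le_div_iff₀ (by linarith)
      (by linarith)]
    linarith
  set q := ‖a‖ ^ 2 + ‖T‖ ^ 2 with hq
  have hq0 : 0 ≤ q := by positivity
  have haq : ‖a‖ ^ 2 ≤ q := by rw [hq]; linarith [sq_nonneg ‖T‖]
  have hBH : |(B * H).trace - (B * T).trace| ≤ ‖B‖ * (2 * (‖S‖ + 1) * (s⁻¹) ^ 2 + 4 * q) := by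
    have e : (B * H).trace - (B * T).trace =
        α * (B * S).trace + α * (B * T).trace - (1 + α) * (B * V).trace := by
      rw [hcov, mul_add, Matrix.trace_add, Matrix.mul_smul, Matrix.mul_smul, Matrix.trace_smul,
        Matrix.trace_smul, mul_sub, Matrix.trace_sub, smul_eq_mul, smul_eq_mul]
      ring
    have h1 := abs_trace_mul_le B S
    have h2 := abs_trace_mul_le B T
    have h3 := abs_trace_mul_le B V
    -- A crude bound is enough here, as `‖T‖` only enters multiplied by `α ≤ 2/n`.
    have hT1 : ‖T‖ ≤ 1 + q := by nlinarith [sq_nonneg (‖T‖ - 1), sq_nonneg ‖a‖]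
    rw [e]
    calc |α * (B * S).trace + α * (B * T).trace - (1 + α) * (B * V).trace|
        ≤ α * |(B * S).trace| + α * |(B * T).trace| + (1 + α) * |(B * V).trace| := by
          refine (abs_sub _ _).trans (add_le_add ((abs_add_le _ _).trans ?_) ?_)
          · rw [abs_mul, abs_mul, abs_of_nonneg hα0]
          · rw [abs_mul, abs_of_nonneg (by linarith)]
      _ ≤ α * (‖B‖ * ‖S‖) + α * (‖B‖ * (1 + q)) + (1 + α) * (‖B‖ * q) := by
          rw [hVn] at h3
          gcongr
          · exact h2.trans (by gcongr)
          · exact h3.trans (by gcongr)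
      _ = ‖B‖ * ((‖S‖ + 1) * α + (1 + 2 * α) * q) := by ring
      _ ≤ ‖B‖ * ((‖S‖ + 1) * (2 * (s⁻¹) ^ 2) + (1 + 2 * 1) * q) := by gcongr
      _ ≤ _ := by gcongr ‖B‖ * ?_; nlinarith
  have hHn : ‖H‖ ^ 2 ≤ 12 * (‖S‖ ^ 2 * (s⁻¹) ^ 4 + q + q ^ 2) := by
    have h1 : ‖H‖ ≤ α * ‖S‖ + 2 * (‖T‖ + ‖a‖ ^ 2) := by
      rw [hcov]
      refine (norm_add_le _ _).trans ?_
      rw [norm_smul, norm_smul, Real.norm_of_nonneg hα0, Real.norm_of_nonneg (by linarith)]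
      have := norm_sub_le T V
      rw [hVn] at this
      gcongr
      linarith
    have h2 : ‖H‖ ≤ 2 * (s⁻¹) ^ 2 * ‖S‖ + 2 * (‖T‖ + ‖a‖ ^ 2) := h1.trans (by gcongr)
    calc ‖H‖ ^ 2 ≤ (2 * (s⁻¹) ^ 2 * ‖S‖ + 2 * (‖T‖ + ‖a‖ ^ 2)) ^ 2 := by gcongr
      -- From `(a+b+c)² ≤ 3(a²+b²+c²)`; the factors `2` inside turn the `3` into `12`.
      _ ≤ 3 * ((2 * (s⁻¹) ^ 2 * ‖S‖) ^ 2 + (2 * ‖T‖) ^ 2 + (2 * ‖a‖ ^ 2) ^ 2) := by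
          nlinarith [sq_nonneg (2 * (s⁻¹) ^ 2 * ‖S‖ - 2 * ‖T‖),
            sq_nonneg (2 * (s⁻¹) ^ 2 * ‖S‖ - 2 * ‖a‖ ^ 2), sq_nonneg (2 * ‖T‖ - 2 * ‖a‖ ^ 2)]
      _ = 12 * (‖S‖ ^ 2 * (s⁻¹) ^ 4 + ‖T‖ ^ 2 + (‖a‖ ^ 2) ^ 2) := by ring
      _ ≤ _ := by
          have h3 : ‖T‖ ^ 2 ≤ q := by rw [hq]; linarith [sq_nonneg ‖a‖]
          gcongr
  have hsi : s * s⁻¹ = 1 := mul_inv_cancel₀ (by linarith)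
  rw [← mul_sub, abs_mul, abs_of_nonneg (by linarith : 0 ≤ s)]
  set w := wassersteinTwoSq (multivariateGaussian (sampleMean x n) (sampleCov x n))
    (multivariateGaussian ν Ξ) - wassersteinTwoSq (multivariateGaussian μ S)
    (multivariateGaussian ν Ξ) with hw
  set l := ((2 : ℝ) • (μ - ν)).ofLp ⬝ᵥ a.ofLp with hl
  have hmain : |w - (l + (B * T).trace)| ≤ ‖B‖ * (2 * (‖S‖ + 1) * (s⁻¹) ^ 2 + 4 * q) + (q +
      c * (12 * (‖S‖ ^ 2 * (s⁻¹) ^ 4 + q + q ^ 2))) := by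
    have e : w - (l + (B * T).trace) =
        ((B * H).trace - (B * T).trace) + (w - (l + (B * H).trace)) := by ring
    rw [e]
    refine (abs_add_le _ _).trans (add_le_add hBH (h.trans ?_))
    gcongr
  refine (mul_le_mul_of_nonneg_left hmain (by linarith : 0 ≤ s)).trans ?_
  exact remainder_bound hs1 hsi hq0 (norm_nonneg B) (norm_nonneg S) hc hU

end Expansion

variable {d : ℕ}

/-! ### Measurability of the estimator. -/

section Measurability

open scoped Matrix.Norms.L2Operator in
-- The infimum over couplings gives no direct access to measurability; the closed formula does, the
-- matrix square root being continuous on positive semidefinite matrices.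
lemma continuous_gaussianWassersteinEstimator (n : ℕ) (ν : EuclideanSpace ℝ (Fin d))
    {Ξ : Matrix (Fin d) (Fin d) ℝ} (hΞ : Ξ.PosDef) :
    Continuous fun x : ℕ → EuclideanSpace ℝ (Fin d) ↦
      gaussianWassersteinEstimator x n (multivariateGaussian ν Ξ) := by
  have h1 : Continuous fun x : ℕ → EuclideanSpace ℝ (Fin d) ↦ sampleMean x n := by
    unfold sampleMean; fun_prop
  have h2 : Continuous fun x : ℕ → EuclideanSpace ℝ (Fin d) ↦ sampleCov x n := by
    have h (i : ℕ) : Continuous fun x : ℕ → EuclideanSpace ℝ (Fin d) ↦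
        Matrix.vecMulVec (x i - sampleMean x n).ofLp (x i - sampleMean x n).ofLp :=
      Continuous.matrix_vecMulVec (by fun_prop) (by fun_prop)
    unfold sampleCov
    fun_prop
  have h3 : Continuous fun x : ℕ → EuclideanSpace ℝ (Fin d) ↦ sandwich (sampleCov x n) Ξ := by
    unfold sandwich; fun_prop
  have h4 : Continuous fun x : ℕ → EuclideanSpace ℝ (Fin d) ↦
      CFC.sqrt (sandwich (sampleCov x n) Ξ) :=
    CFC.continuousOn_sqrt.comp_continuous h3 fun x ↦
      (posSemidef_sandwich (posSemidef_sampleCov x n) Ξ).nonneg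
  simp only [gaussianWassersteinEstimator,
    wassersteinTwoSq_multivariateGaussian_eq (posSemidef_sampleCov _ n) hΞ]
  have h5 := h2.matrix_trace
  have h6 := h4.matrix_trace
  fun_prop

end Measurability

/-! ### Second moments of averages and convergence in probability. -/

section Averages

variable {Ω : Type*} [MeasurableSpace Ω] {Pr : Measure Ω} [IsProbabilityMeasure Pr]
  {E : Type*} [MeasurableSpace E] {P : Measure E} {X : ℕ → Ω → E}

/-- The second moment of the average of centered independent random variables. -/
lemma integrable_and_integral_average_sq (hlaw : ∀ i, HasLaw (X i) P Pr) (hindep : iIndepFun X Pr)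
    {f : E → ℝ} (hf : Measurable f) (hf2 : MemLp f 2 P) (hf0 : ∫ x, f x ∂P = 0) {n : ℕ}
    (hn : n ≠ 0) :
    Integrable (fun ω ↦ ((n : ℝ)⁻¹ * ∑ i ∈ Finset.range n, f (X i ω)) ^ 2) Pr ∧
      ∫ ω, ((n : ℝ)⁻¹ * ∑ i ∈ Finset.range n, f (X i ω)) ^ 2 ∂Pr = (n : ℝ)⁻¹ * Var[f; P] := by
  have hX i := (hlaw i).aemeasurable
  have hm (i) : MemLp (fun ω ↦ f (X i ω)) 2 Pr := by
    have := hf2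
    rw [← (hlaw i).map_eq] at this
    exact (memLp_map_measure_iff hf.aestronglyMeasurable (hX i)).1 this
  have hv (i) : Var[fun ω ↦ f (X i ω); Pr] = Var[f; P] := by
    rw [← (hlaw i).map_eq, variance_map hf.aemeasurable (hX i)]
    rfl
  have hi (i) : ∫ ω, f (X i ω) ∂Pr = 0 := by
    rw [← hf0, ← (hlaw i).map_eq, integral_map (hX i) hf.aestronglyMeasurable]
  have hs : MemLp (fun ω ↦ (n : ℝ)⁻¹ * ∑ i ∈ Finset.range n, f (X i ω)) 2 Pr :=
    (memLp_finsetSum _ fun i _ ↦ hm i).const_mul _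
  refine ⟨hs.integrable_sq, ?_⟩
  have h0 : ∫ ω, (n : ℝ)⁻¹ * ∑ i ∈ Finset.range n, f (X i ω) ∂Pr = 0 := by
    rw [integral_const_mul, integral_finsetSum _ fun i _ ↦ (hm i).integrable (by simp)]
    simp [hi]
  rw [← variance_of_integral_eq_zero hs.aemeasurable h0, variance_const_mul]
  have hsum : (fun ω ↦ ∑ i ∈ Finset.range n, f (X i ω)) =
      ∑ i ∈ Finset.range n, fun ω ↦ f (X i ω) := by ext; simp
  rw [hsum, IndepFun.variance_sum (fun i _ ↦ hm i)
    fun i _ j _ hij ↦ (hindep.indepFun hij).comp hf hf]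
  simp only [hv, Finset.sum_const, Finset.card_range, nsmul_eq_mul]
  have : (n : ℝ) ≠ 0 := by exact_mod_cast hn
  field_simp

/-- A sequence dominated by `c (U + U² + n^{-1/2})` with `U ≥ 0` of mean `O(n^{-1/2})` tends to zero
in probability. -/
lemma tendstoInMeasure_zero_of_bound {V U : ℕ → Ω → ℝ} {c v : ℝ} (hc : 0 ≤ c)
    (hV : ∀ n, 2 ≤ n → ∀ ω, |V n ω| ≤ c * (U n ω + U n ω ^ 2 + (√n)⁻¹))
    (hU0 : ∀ n ω, 0 ≤ U n ω) (hUi : ∀ n, 2 ≤ n → Integrable (U n) Pr)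
    (hU : ∀ n, 2 ≤ n → ∫ ω, U n ω ∂Pr ≤ v * (√n)⁻¹) :
    TendstoInMeasure Pr V atTop 0 := by
  rw [tendstoInMeasure_iff_measureReal_norm]
  intro ε hε
  -- If `U` and `n^{-1/2}` are below `δ ≤ 1`, then `U² ≤ δ` and the bound is at most `3cδ < ε`. So a
  -- deviation forces `U ≥ δ`, which Markov's inequality makes unlikely.
  set δ := min 1 (ε / (4 * (c + 1))) with hδ
  have hδ0 : 0 < δ := by positivity
  have hsq : Tendsto (fun n : ℕ ↦ (√(n : ℝ))⁻¹) atTop (nhds 0) :=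
    tendsto_inv_atTop_zero.comp (Real.tendsto_sqrt_atTop.comp tendsto_natCast_atTop_atTop)
  have hlim : Tendsto (fun n : ℕ ↦ δ⁻¹ * (v * (√(n : ℝ))⁻¹)) atTop (nhds 0) := by
    simpa using (hsq.const_mul v).const_mul δ⁻¹
  refine squeeze_zero' (Eventually.of_forall fun _ ↦ measureReal_nonneg) ?_ hlim
  filter_upwards [eventually_ge_atTop 2, hsq.eventually (gt_mem_nhds hδ0)] with n hn hn'
  have hsub : {ω | ε ≤ ‖V n ω - (0 : Ω → ℝ) ω‖} ⊆ {ω | δ ≤ U n ω} := by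
    intro ω hω
    by_contra hlt
    simp only [Set.mem_ofPred_eq, Pi.zero_apply, sub_zero, Real.norm_eq_abs, not_le] at hω hlt
    have h1 := hω.trans (hV n hn ω)
    have h2 : U n ω ^ 2 ≤ δ := by
      have := hU0 n ω
      have h3 : U n ω ≤ 1 := hlt.le.trans (min_le_left _ _)
      nlinarith
    have h4 : c * (U n ω + U n ω ^ 2 + (√n)⁻¹) ≤ c * (3 * δ) := by
      gcongr
      linarith
    have h5 : (c + 1) * (4 * δ) ≤ ε := by
      have := min_le_right 1 (ε / (4 * (c + 1)))
      rw [← hδ, le_div_iff₀ (by positivity)] at this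
      linarith
    nlinarith
  have hmark := mul_meas_ge_le_integral_of_nonneg (ae_of_all Pr (hU0 n)) (hUi n hn) δ
  calc Pr.real {ω | ε ≤ ‖V n ω - (0 : Ω → ℝ) ω‖} ≤ Pr.real {ω | δ ≤ U n ω} := measureReal_mono hsub
    _ = δ⁻¹ * (δ * Pr.real {ω | δ ≤ U n ω}) := by
        rw [← mul_assoc, inv_mul_cancel₀ hδ0.ne', one_mul]
    _ ≤ _ := mul_le_mul_of_nonneg_left (hmark.trans (hU n hn)) (by positivity)

end Averages

/-! ### Fluctuations of the empirical moments and the linearized estimator. -/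

section Moments

variable {μ ν : EuclideanSpace ℝ (Fin d)} {S Ξ : Matrix (Fin d) (Fin d) ℝ}
  {Ω : Type*} [MeasurableSpace Ω] {Pr : Measure Ω} [IsProbabilityMeasure Pr]
  {X : ℕ → Ω → EuclideanSpace ℝ (Fin d)}

lemma memLp_eval_sub_mul_sub (i j : Fin d) (c : ℝ) :
    MemLp (fun x ↦ (x - μ).ofLp i * (x - μ).ofLp j - c) 2 (multivariateGaussian μ S) := by
  -- A product of two coordinates is square integrable by Hölder with `1/4 + 1/4 = 1/2`.
  have : ENNReal.HolderTriple 4 4 2 := by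
    constructor
    have : (2 : ℝ≥0∞)⁻¹ = 2 * 4⁻¹ := by
      have h4 : (4 : ℝ≥0∞) = 2 * 2 := by norm_num
      rw [h4, ENNReal.mul_inv (by simp) (by simp), ← mul_assoc,
        ENNReal.mul_inv_cancel (by simp) (by simp), one_mul]
    rw [this, two_mul]
  refine MemLp.sub ?_ (memLp_const c)
  exact (memLp_eval_sub (p := 4) j (by simp)).mul (memLp_eval_sub (p := 4) i (by simp))

open scoped Matrix.Norms.Frobenius in
/-- The fluctuations of the first two empirical moments are of order `n^{-1/2}`. -/
lemma exists_integral_fluctuation_le (hS : S.PosSemidef)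
    (hlaw : ∀ i, HasLaw (X i) (multivariateGaussian μ S) Pr) (hindep : iIndepFun X Pr) :
    ∃ v, ∀ n : ℕ, n ≠ 0 →
      Integrable (fun ω ↦ √n * (‖sampleMean (fun i ↦ X i ω) n - μ‖ ^ 2 +
        ‖secondMomentDev μ S (fun i ↦ X i ω) n‖ ^ 2)) Pr ∧
      ∫ ω, √n * (‖sampleMean (fun i ↦ X i ω) n - μ‖ ^ 2 +
        ‖secondMomentDev μ S (fun i ↦ X i ω) n‖ ^ 2) ∂Pr ≤ v * (√n)⁻¹ := by
  have h1 (i : Fin d) {n : ℕ} (hn : n ≠ 0) := integrable_and_integral_average_sq hlaw hindep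
    (f := fun x ↦ (x - μ).ofLp i) (by fun_prop) (memLp_eval_sub i (by simp))
    (integral_eval_sub i) hn
  have h2 (i j : Fin d) {n : ℕ} (hn : n ≠ 0) := integrable_and_integral_average_sq hlaw hindep
    (f := fun x ↦ (x - μ).ofLp i * (x - μ).ofLp j - S i j) (by fun_prop)
    (memLp_eval_sub_mul_sub i j _) (by
      rw [integral_sub (integrable_eval_sub_mul i j) (integrable_const _),
        integral_eval_sub_mul hS]
      simp) hn
  refine ⟨∑ i, Var[fun x ↦ (x - μ).ofLp i; multivariateGaussian μ S] + ∑ i, ∑ j,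
    Var[fun x ↦ (x - μ).ofLp i * (x - μ).ofLp j - S i j; multivariateGaussian μ S],
    fun n hn ↦ ?_⟩
  have e1 (ω) : ‖sampleMean (fun i ↦ X i ω) n - μ‖ ^ 2 =
      ∑ i, ((n : ℝ)⁻¹ * ∑ k ∈ Finset.range n, (X k ω - μ).ofLp i) ^ 2 := by
    rw [sampleMean_sub μ _ hn, EuclideanSpace.real_norm_sq_eq]
    simp
  have e2 (ω) : ‖secondMomentDev μ S (fun i ↦ X i ω) n‖ ^ 2 = ∑ i, ∑ j, ((n : ℝ)⁻¹ *
      ∑ k ∈ Finset.range n, ((X k ω - μ).ofLp i * (X k ω - μ).ofLp j - S i j)) ^ 2 := by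
    rw [frobenius_norm_sq]
    simp only [secondMomentDev, Matrix.smul_apply, Matrix.sum_apply, Matrix.sub_apply,
      Matrix.vecMulVec_apply, smul_eq_mul]
  simp only [e1, e2]
  have i1 := integrable_finsetSum Finset.univ fun i _ ↦ (h1 i hn).1
  have i2 := integrable_finsetSum Finset.univ fun i _ ↦
    integrable_finsetSum Finset.univ fun j _ ↦ (h2 i j hn).1
  refine ⟨(i1.add i2).const_mul _, le_of_eq ?_⟩
  rw [integral_const_mul, integral_add i1 i2, integral_finsetSum _ fun i _ ↦ (h1 i hn).1,
    integral_finsetSum _ fun i _ ↦ integrable_finsetSum _ fun j _ ↦ (h2 i j hn).1]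
  simp only [integral_finsetSum Finset.univ fun j _ ↦ (h2 _ j hn).1, (h1 _ hn).2, (h2 _ _ hn).2,
    ← Finset.mul_sum, ← mul_add]
  have hs : √(n : ℝ) ≠ 0 := Real.sqrt_ne_zero'.2 (by exact_mod_cast Nat.pos_of_ne_zero hn)
  have : √(n : ℝ) * (n : ℝ)⁻¹ = (√(n : ℝ))⁻¹ := by
    conv_lhs => rw [← Real.mul_self_sqrt (Nat.cast_nonneg n), Real.sqrt_mul_self (by positivity)]
    field_simp
  rw [← mul_assoc, this, mul_comm]

/-- Identifies the derivative evaluated at the empirical deviations with the normalized sum of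
scalars to which the central limit theorem applies, using `tr(B v vᵗ) = vᵗ B v`. -/
lemma linearization_eq (b : EuclideanSpace ℝ (Fin d)) (B : Matrix (Fin d) (Fin d) ℝ)
    (x : ℕ → EuclideanSpace ℝ (Fin d)) {n : ℕ} (hn : n ≠ 0) :
    (√n)⁻¹ * (∑ i ∈ Finset.range n, (b.ofLp ⬝ᵥ (x i - μ).ofLp +
        (x i - μ).ofLp ⬝ᵥ B *ᵥ (x i - μ).ofLp) - n * (B * S).trace) =
      √n * (b.ofLp ⬝ᵥ (sampleMean x n - μ).ofLp + (B * secondMomentDev μ S x n).trace) := by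
  have hs : √(n : ℝ) ≠ 0 := Real.sqrt_ne_zero'.2 (by exact_mod_cast Nat.pos_of_ne_zero hn)
  have hsn : (√(n : ℝ))⁻¹ = √(n : ℝ) * (n : ℝ)⁻¹ := by
    conv_rhs => rw [← Real.mul_self_sqrt (Nat.cast_nonneg n), Real.sqrt_mul_self (by positivity)]
    field_simp
  have htr (i) : (B * Matrix.vecMulVec (x i - μ).ofLp (x i - μ).ofLp).trace =
      (x i - μ).ofLp ⬝ᵥ B *ᵥ (x i - μ).ofLp := by
    rw [Matrix.mul_vecMulVec, Matrix.trace_vecMulVec, dotProduct_comm]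
  have h1 : (B * secondMomentDev μ S x n).trace = (n : ℝ)⁻¹ *
      (∑ i ∈ Finset.range n, (x i - μ).ofLp ⬝ᵥ B *ᵥ (x i - μ).ofLp - n * (B * S).trace) := by
    rw [secondMomentDev, Matrix.mul_smul, Matrix.trace_smul, Matrix.mul_sum, Matrix.trace_sum,
      smul_eq_mul]
    simp only [mul_sub B, Matrix.trace_sub, htr, Finset.sum_sub_distrib]
    simp
  have h2 : b.ofLp ⬝ᵥ (sampleMean x n - μ).ofLp = (n : ℝ)⁻¹ *
      ∑ i ∈ Finset.range n, b.ofLp ⬝ᵥ (x i - μ).ofLp := by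
    rw [sampleMean_sub μ x hn, WithLp.ofLp_smul, dotProduct_smul, WithLp.ofLp_sum, dotProduct_sum,
      smul_eq_mul]
  rw [h1, h2, hsn, Finset.sum_add_distrib]
  ring

open scoped Matrix.Norms.Frobenius in
/-- The difference between the rescaled estimator and its linearization vanishes in probability. -/
lemma tendstoInMeasure_remainder (hS : S.PosDef) (hΞ : Ξ.PosDef)
    (hlaw : ∀ i, HasLaw (X i) (multivariateGaussian μ S) Pr) (hindep : iIndepFun X Pr) :
    TendstoInMeasure Pr (fun (n : ℕ) ω ↦ √n * (gaussianWassersteinEstimator (fun i ↦ X i ω) n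
        (multivariateGaussian ν Ξ) -
        wassersteinTwoSq (multivariateGaussian μ S) (multivariateGaussian ν Ξ)) -
      (√n)⁻¹ * (∑ i ∈ Finset.range n, (((2 : ℝ) • (μ - ν)).ofLp ⬝ᵥ (X i ω - μ).ofLp +
        (X i ω - μ).ofLp ⬝ᵥ (1 - optimalMap S Ξ) *ᵥ (X i ω - μ).ofLp) -
        n * ((1 - optimalMap S Ξ) * S).trace)) atTop 0 := by
  obtain ⟨c, hc, hexp⟩ := exists_estimator_expansion μ ν hS hΞ
  obtain ⟨v, hv⟩ := exists_integral_fluctuation_le hS.posSemidef hlaw hindep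
  refine tendstoInMeasure_zero_of_bound hc (U := fun n ω ↦ √n *
    (‖sampleMean (fun i ↦ X i ω) n - μ‖ ^ 2 + ‖secondMomentDev μ S (fun i ↦ X i ω) n‖ ^ 2))
    (fun n hn ω ↦ ?_) (fun n ω ↦ by positivity) (fun n hn ↦ (hv n (by omega)).1)
    (fun n hn ↦ (hv n (by omega)).2)
  refine le_trans (le_of_eq ?_) (hexp (fun i ↦ X i ω) n hn _ rfl)
  rw [← linearization_eq _ _ _ (by omega)]

end Moments

end GaussianWasserstein

/-! ### The limit theorem. -/

theorem theoremT {d : ℕ} (μ ν : EuclideanSpace ℝ (Fin d)) (S Ξ : Matrix (Fin d) (Fin d) ℝ)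
    (hS : S.PosDef) (hΞ : Ξ.PosDef)
    (hne : multivariateGaussian μ S ≠ multivariateGaussian ν Ξ)
    {Ω : Type*} [MeasurableSpace Ω] (Pr : Measure Ω) [IsProbabilityMeasure Pr]
    (X : ℕ → Ω → EuclideanSpace ℝ (Fin d))
    (hlaw : ∀ i, HasLaw (X i) (multivariateGaussian μ S) Pr)
    (hindep : iIndepFun X Pr)
    (κ : Fin d → ℝ) (r : OrthonormalBasis (Fin d) ℝ (EuclideanSpace ℝ (Fin d)))
    (heig : GaussianWasserstein.IsEigendecomposition (GaussianWasserstein.sandwich S Ξ) κ r) :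
    0 ≤ GaussianWasserstein.asympVariance μ ν S Ξ κ r ∧
    TendstoInDistribution
      (fun (n : ℕ) (ω : Ω) ↦ √(n : ℝ) *
        (GaussianWasserstein.gaussianWassersteinEstimator (fun i ↦ X i ω) n
            (multivariateGaussian ν Ξ)
          - GaussianWasserstein.wassersteinTwoSq
              (multivariateGaussian μ S) (multivariateGaussian ν Ξ)))
      atTop (id : ℝ → ℝ) (fun _ ↦ Pr)
      (gaussianReal 0 (GaussianWasserstein.asympVariance μ ν S Ξ κ r).toNNReal) := by
  open GaussianWasserstein in
  set b := (2 : ℝ) • (μ - ν) with hb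
  set B := 1 - optimalMap S Ξ with hB
  set h : EuclideanSpace ℝ (Fin d) → ℝ := fun x ↦
    b.ofLp ⬝ᵥ (x - μ).ofLp + (x - μ).ofLp ⬝ᵥ B *ᵥ (x - μ).ofLp with hh
  have hhm : Measurable h := by
    have : Continuous h := by simp only [hh, dotProduct]; fun_prop
    exact this.measurable
  obtain ⟨hmem, hvar⟩ := quadratic_multivariateGaussian (m := μ) hS.posSemidef
    (transpose_one_sub_optimalMap S Ξ) b
  rw [← hB, ← asympVariance_eq hS hΞ heig] at hvar
  have hX i := (hlaw i).aemeasurable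
  have hvar' : Var[h ∘ X 0; Pr] = asympVariance μ ν S Ξ κ r := by
    rw [← hvar, ← (hlaw 0).map_eq, variance_map hhm.aemeasurable (hX 0)]
  have hmean : ∫ ω, (h ∘ X 0) ω ∂Pr = (B * S).trace := by
    rw [← integral_linear_add_quadratic (m := μ) hS.posSemidef b B, ← (hlaw 0).map_eq,
      integral_map (hX 0) hhm.aestronglyMeasurable]
    rfl
  have hmem' : MemLp (h ∘ X 0) 2 Pr := by
    rw [← (hlaw 0).map_eq] at hmem
    exact (memLp_map_measure_iff hhm.aestronglyMeasurable (hX 0)).1 hmem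
  refine ⟨hvar ▸ variance_nonneg _ _, ?_⟩
  have hclt := tendstoInDistribution_inv_sqrt_mul_sum_sub (X := fun i ↦ h ∘ X i) (P := Pr)
    (Y := (id : ℝ → ℝ)) (P' := gaussianReal 0 (asympVariance μ ν S Ξ κ r).toNNReal)
    (by rw [hvar']; exact HasLaw.id) hmem' (hindep.comp (fun _ ↦ h) fun _ ↦ hhm)
    (fun i ↦ IdentDistrib.comp ⟨hX i, hX 0, by rw [(hlaw i).map_eq, (hlaw 0).map_eq]⟩ hhm)
  rw [hmean] at hclt
  -- Slutsky: the estimator differs from the linear statistic by a term vanishing in probability.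
  refine tendstoInDistribution_of_tendstoInMeasure_sub _ _ hclt ?_ fun n ↦ ?_
  · exact tendstoInMeasure_remainder hS hΞ hlaw hindep
  · have h1 : AEMeasurable (fun ω i ↦ X i ω) Pr := aemeasurable_pi_iff.2 hX
    have h2 := (continuous_gaussianWassersteinEstimator n ν hΞ).measurable.comp_aemeasurable h1
    exact (h2.sub_const _).const_mul _
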